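/- Let $k=\mathbb F_q$ be a finite field and let $C$ be a hyperelliptic curve of genus $g\ge 1$ over $k$ (elliptic curves included): the smooth, projective, geometrically integral curve with affine equation $y^2+h(x)y=f(x)$, where $f,h\in k[x]$, $f$ is monic of degree $2g+1$ and $\deg h\le g$, with the finite double cover $\pi:C\to\mathbb P^1$ that is $(x,y)\mapsto x$ on the affine part. For a closed point $y$ of $C$ over $x$ let $e(y\mid x)$ be the ramification index and $f(y\mid x)=[k(y):k(x)]$ the inertia degree. Call a closed point $x\in|\mathbb P^1|$ *ramified* if $e(y\mid x)>1$ for some $y\in\pi^{-1}(x)$, *split* if $e(y\mid x)=f(y\mid x)=1$ for all $y\in\pi^{-1}(x)$, and *inert* if $\pi^{-1}(x)$ is a single closed point $y$ and $e(y\mid x)=1$. Effective $0$-cycles are finite sums of closed points with coefficients in $\mathbb N$, and $\pi_*(y)=[k(y):k(\pi(y))]\,\pi(y)$. Objective linear algebra. For a set $B$, a span $B\xleftarrow{v}M\to *$ represents the linear functor $\mathrm{Set}_{/B}\to\mathrm{Set}$ that pulls back along $v$ and then forgets the map to $M$; sums are disjoint unions of spans. A commutative monoid $S$ is viewed as the decomposition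 set with $S_1=S$, $S_2=S\times S$ and faces $d_2(a,b)=a$, $d_0(a,b)=b$, $d_1(a,b)=a+b$. Its objective incidence algebra consists of the linear functors represented by spans $S_1\leftarrow M\to *$; the convolution of $F=(S_1\xleftarrow{v}M\to *)$ and $G=(S_1\xleftarrow{w}N\to *)$ is represented by $S_1\xleftarrow{d_1}S_2\times_{S_1\times S_1}(M\times N)\to *$, the pullback being along $(d_2,d_0)$ and $v\times w$. The zeta functor is $S_1\xleftarrow{\mathrm{id}}S_1\to *$. If all fibres are finite, the cardinality of $F$ is the function $|F|(\alpha)=|v^{-1}(\alpha)|$. Fix $x\in|\mathbb P^1|$. Let $S_x=\{ax : a\ge 0\}$, let $T_x$ be the monoid of effective $0$-cycles $\beta$ on $C$ with $\pi_*\beta\in S_x$, and let $\zeta_{\mathbb P^1,x}$ and $\zeta_{C,x}$ be the zeta functors of $S_x$ and $T_x$. Let $\pi_*\zeta_{C,x}$ be the linear functor of the span $S_x\xleftarrow{\pi_*}T_x\to *$, and let $L_x(C)^{\pm}$ be the linear functors of the spans $S_x\hookleftarrow S_x^{\pm}\to *$, where - if $x$ is ramified, $S_x^+=\{0\}$ and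 $S_x^-=\varnothing$; - if $x$ is split, $S_x^+=S_x$ and $S_x^-=\varnothing$; - if $x$ is inert, $S_x^+=\{2nx : n\ge 0\}$ and $S_x^-=\{(2n+1)x : n\ge 0\}$. **Theorem.** For every closed point $x\in|\mathbb P^1|$: 1. $x$ is exactly one of ramified, split, inert. 2. In the incidence algebra of $S_x$ there is an equivalence of linear functors $$\pi_*\zeta_{C,x}+\zeta_{\mathbb P^1,x}*L_x(C)^-\;\cong\;\zeta_{\mathbb P^1,x}*L_x(C)^+ ,$$ that is, a natural isomorphism, and also a bijection between the apices of the representing spans that commutes with the maps to $S_x$. 3. Let $\chi(x)=0,1,-1$ if $x$ is ramified, split, inert respectively, let $\deg(z)=[k(z):k]$ for closed points $z$ of $\mathbb P^1$ and of $C$, extended linearly to $0$-cycles, and put $$Z_x(C,t)=\prod_{y\in\pi^{-1}(x)}\frac1{1-t^{\deg(y)}},\qquad Z_x(\mathbb P^1,t)=\frac1{1-t^{\deg(x)}},\qquad L_x(C,t)=\frac1{1-\chi(x)t^{\deg(x)}}$$ in $\mathbb Z[[t]]$. The functors $\pi_*\zeta_{C,x}$, $\zeta_{\mathbb P^1,x}$,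 $L_x(C)^{+}$ and $L_x(C)^-$ have finite fibres. The generating functions $\sum_{\alpha\in S_x}|F|(\alpha)t^{\deg\alpha}$ of their cardinalities are $Z_x(C,t)$ for $\pi_*\zeta_{C,x}$ and $Z_x(\mathbb P^1,t)$ for $\zeta_{\mathbb P^1,x}$, and the one of $L_x(C)^+$ minus the one of $L_x(C)^-$ is $L_x(C,t)$. Moreover $$Z_x(C,t)=Z_x(\mathbb P^1,t)\cdot L_x(C,t).$$ -/

import Mathlib

universe u

namespace HyperellipticIncidence

open CategoryTheory AlgebraicGeometry

noncomputable section

/-! ## The projective line -/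

/-- The standard grading by degree on `k[X₀, X₁]`. -/
abbrev grading (k : Type u) [Field k] : ℕ → Submodule k (MvPolynomial (Fin 2) k) :=
  MvPolynomial.homogeneousSubmodule (Fin 2) k

instance gradedAlgebra (k : Type u) [Field k] : GradedAlgebra (grading k) := MvPolynomial.gradedAlgebra

/-- The projective line `ℙ¹_k = Proj k[X₀, X₁]`. -/
abbrev P1 (k : Type u) [Field k] : Scheme.{u} := Proj (grading k)

/-- The structure morphism `ℙ¹_k ⟶ Spec k`. -/
def P1.toSpec (k : Type u) [Field k] : P1 k ⟶ Spec (.of k) :=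
  Proj.toSpecZero (grading k) ≫ Spec.map (CommRingCat.ofHom (algebraMap k (grading k 0)))

/-- Dehomogenization `(k[X₀, X₁]_{X₀})₀ → k[x]`, with `X₀ ↦ 1` and `X₁ ↦ x`. -/
def P1.dehomogenize (k : Type u) [Field k] :
    HomogeneousLocalization.Away (grading k) (MvPolynomial.X 0) →+* Polynomial k :=
  (IsLocalization.Away.lift (S := Localization.Away (MvPolynomial.X 0 : MvPolynomial (Fin 2) k))
      (g := (MvPolynomial.aeval ![(1 : Polynomial k), Polynomial.X]).toRingHom)
      (MvPolynomial.X 0 : MvPolynomial (Fin 2) k) (by simp)).comp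
    (algebraMap (HomogeneousLocalization.Away (grading k) (MvPolynomial.X 0)) _)

/-- The standard affine chart `𝔸¹ = Spec k[x] ⟶ ℙ¹`, with `x = X₁ / X₀`; its image is `X₀ ≠ 0`. -/
def P1.affineChart (k : Type u) [Field k] : Spec (.of (Polynomial k)) ⟶ P1 k :=
  Spec.map (CommRingCat.ofHom (P1.dehomogenize k)) ≫
    Proj.awayι (grading k) (MvPolynomial.X 0) (MvPolynomial.isHomogeneous_X k 0) Nat.one_pos

/-! ## Hyperelliptic curves -/

/-- The coordinate ring `k[x][y] / (y² + h(x) y - f(x))`. -/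
abbrev AffineRing {k : Type u} [Field k] (f h : Polynomial k) : Type u :=
  AdjoinRoot (Polynomial.X ^ 2 + Polynomial.C h * Polynomial.X - Polynomial.C f :
    Polynomial (Polynomial k))

/-- The affine plane curve `y² + h(x) y = f(x)`. -/
def affineCurve {k : Type u} [Field k] (f h : Polynomial k) : Scheme.{u} :=
  Spec (.of (AffineRing f h))

/-- The projection `(x, y) ↦ x` of the affine curve to the affine line. -/
def affineProj {k : Type u} [Field k] (f h : Polynomial k) :
    affineCurve f h ⟶ Spec (.of (Polynomial k)) :=
  Spec.map (CommRingCat.ofHom (algebraMap (Polynomial k) (AffineRing f h)))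

/-- The part of `C` over `𝔸¹ ⊆ ℙ¹` is the affine curve `y² + h(x) y = f(x)`, and there `π` is the
projection to `x`. -/
def HasAffineEquation {k : Type u} [Field k] {C : Scheme.{u}} (π : C ⟶ P1 k)
    (f h : Polynomial k) : Prop :=
  ∃ chart : affineCurve f h ⟶ C, IsPullback chart (affineProj f h) π (P1.affineChart k)

/-- A hyperelliptic curve of genus `g ≥ 1` over `k` (elliptic curves included) with its double
cover `π : C ⟶ ℙ¹`: the smooth projective geometrically integral curve with affine equation
`y² + h(x) y = f(x)`, where `f` is monic of degree `2 g + 1` and `deg h ≤ g`. The curve is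
projective over `k` because `π` is finite; over the affine line, `π` is the projection
`(x, y) ↦ x`. -/
structure HyperellipticCurve (k : Type u) [Field k] where
  /-- the genus -/
  g : ℕ
  one_le_g : 1 ≤ g
  f : Polynomial k
  h : Polynomial k
  monic_f : f.Monic
  natDegree_f : f.natDegree = 2 * g + 1
  natDegree_h : h.natDegree ≤ g
  /-- the curve -/
  C : Scheme.{u}
  /-- the double cover -/
  π : C ⟶ P1 k
  smooth : SmoothOfRelativeDimension 1 (π ≫ P1.toSpec k)
  geometricallyIntegral : GeometricallyIntegral (π ≫ P1.toSpec k)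
  finite : IsFinite π
  hasAffineEquation : HasAffineEquation π f h

attribute [instance] HyperellipticCurve.smooth HyperellipticCurve.geometricallyIntegral
  HyperellipticCurve.finite

/-- The structure morphism `C ⟶ Spec k`. -/
abbrev HyperellipticCurve.toSpec {k : Type u} [Field k] (H : HyperellipticCurve k) :
    H.C ⟶ Spec (.of k) :=
  H.π ≫ P1.toSpec k

/-! ## Closed points and effective `0`-cycles -/

/-- The set `|X|` of closed points. -/
abbrev ClosedPoint (X : Scheme.{u}) : Type u := closedPoints X

/-- The action of a finite morphism on closed points. -/
def ClosedPoint.map {Y X : Scheme.{u}} (p : Y ⟶ X) [IsFinite p] (y : ClosedPoint Y) :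
    ClosedPoint X :=
  ⟨p y.1, by
    have hy : IsClosed {y.1} := y.2
    have := p.isClosedMap _ hy
    rwa [Set.image_singleton] at this⟩

/-- The monoid of effective `0`-cycles, the free commutative monoid on the closed points. -/
abbrev EffZeroCycle (X : Scheme.{u}) : Type u := ClosedPoint X →₀ ℕ

/-- The degree `deg (∑ aₓ x) = ∑ aₓ [k(x) : k]` of a `0`-cycle on `s : X ⟶ Spec k`. -/
def EffZeroCycle.degree {k : Type u} [Field k] {X : Scheme.{u}} (s : X ⟶ Spec (.of k)) :
    EffZeroCycle X →+ ℕ :=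
  Finsupp.liftAddHom fun x => AddMonoidHom.mulRight (s.residueDegree x.1)

/-- Pushforward of `0`-cycles, `y ↦ [k(y) : k(p(y))] p(y)` on closed points. -/
def EffZeroCycle.pushforward {Y X : Scheme.{u}} (p : Y ⟶ X) [IsFinite p] :
    EffZeroCycle Y →+ EffZeroCycle X :=
  Finsupp.liftAddHom fun y =>
    (Finsupp.singleAddHom (ClosedPoint.map p y)).comp
      (AddMonoidHom.mulRight (p.residueDegree y.1))

/-! ## Linear functors and the objective incidence algebra of a commutative monoid

A commutative monoid `M` is a decomposition set through its bar construction: its `1`-simplices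
are the elements of `M`, its `2`-simplices are the pairs `σ = (a, b)`, with faces `d₂ σ = a`,
`d₀ σ = b` and `d₁ σ = a + b`. -/

/-- An objective linear functional on the basis `B`, i.e. a span `B ← apex → *`. -/
structure LinFun (B : Type u) where
  apex : Type u
  leg : apex → B

namespace LinFun

variable {B B' : Type u}

/-- The linear functor `Set_{/B} ⥤ Set` of the span `B ←v M → *`: pull back along `v`, and forget
the map to `M`. -/
def toFunctor (F : LinFun B) : Over B ⥤ Type u where
  obj X := {p : X.left × F.apex // X.hom p.1 = F.leg p.2}
  map {X Y} φ := TypeCat.ofHom fun p => ⟨(φ.left p.1.1, p.1.2), by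
    have h : Y.hom (φ.left p.1.1) = X.hom p.1.1 := ConcreteCategory.congr_hom (Over.w φ) p.1.1
    exact h.trans p.2⟩

/-- Equivalence of spans: a bijection of the apices that commutes with the legs. -/
def SpanEquiv (F G : LinFun B) : Prop :=
  ∃ φ : F.apex ≃ G.apex, ∀ m, G.leg (φ m) = F.leg m

/-- Equivalence of linear functors: a natural isomorphism. -/
def FunctorEquiv (F G : LinFun B) : Prop := Nonempty (F.toFunctor ≅ G.toFunctor)

/-- The sum of two functionals. -/
protected def add (F G : LinFun B) : LinFun B where
  apex := F.apex ⊕ G.apex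
  leg := Sum.elim F.leg G.leg

/-- The functional of a subset of the basis, with its inclusion as leg. -/
def ofSet (A : Set B) : LinFun B where
  apex := A
  leg := Subtype.val

/-- Pushforward along a map of bases, by composition with the leg. -/
def pushforward (π : B → B') (F : LinFun B) : LinFun B' where
  apex := F.apex
  leg := π ∘ F.leg

/-- All fibres of the leg are finite, so that the cardinality is defined. -/
def LocallyFinite (F : LinFun B) : Prop := ∀ b, Finite {m : F.apex // F.leg m = b}

/-- The cardinality `|F| : b ↦ |v⁻¹(b)|` of `B ←v M → *`. -/
def card (F : LinFun B) (b : B) : ℕ := Nat.card {m : F.apex // F.leg m = b}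

end LinFun

/-- The `2`-simplices of the bar construction. -/
abbrev TwoSimplex (M : Type u) : Type u := M × M

def TwoSimplex.d₀ {M : Type u} (σ : TwoSimplex M) : M := σ.2
def TwoSimplex.d₁ {M : Type u} [AddCommMonoid M] (σ : TwoSimplex M) : M := σ.1 + σ.2
def TwoSimplex.d₂ {M : Type u} (σ : TwoSimplex M) : M := σ.1

/-- The zeta functor: the span `M ← M → *` with the identity as leg. -/
def zeta (M : Type u) : LinFun M where
  apex := M
  leg := id

/-- Convolution `F * G`: the pullback of `(d₂, d₀)` along the product of the legs of `F` and `G`,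
mapped to the `1`-simplices by `d₁`. -/
def conv {M : Type u} [AddCommMonoid M] (F G : LinFun M) : LinFun M where
  apex := {p : TwoSimplex M × (F.apex × G.apex) //
    (p.1.d₂, p.1.d₀) = (F.leg p.2.1, G.leg p.2.2)}
  leg p := p.1.1.d₁

/-! ## Splitting types -/

namespace HyperellipticCurve

variable {k : Type u} [Field k] (H : HyperellipticCurve k) (x : ClosedPoint (P1 k))

/-- The fibre `π⁻¹(x)` in the closed points of `C`. -/
abbrev Fibre : Type u := {y : ClosedPoint H.C // ClosedPoint.map H.π y = x}

/-- The ramification index `e(y | π(y))` of the local rings `𝒪_{ℙ¹, π(y)} → 𝒪_{C, y}`. -/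
def ramificationIndex (y : ClosedPoint H.C) : ℕ :=
  letI := (H.π.stalkMap y.1).hom.toAlgebra
  (IsLocalRing.maximalIdeal (H.C.presheaf.stalk y.1)).ramificationIdx
    ((P1 k).presheaf.stalk (H.π y.1))

/-- The inertia degree `f(y | π(y)) = [k(y) : k(π(y))]`. -/
def inertiaDegree (y : ClosedPoint H.C) : ℕ := H.π.residueDegree y.1

def IsRamified : Prop := ∃ y : H.Fibre x, 1 < H.ramificationIndex y.1

def IsSplit : Prop := ∀ y : H.Fibre x, H.ramificationIndex y.1 = 1 ∧ H.inertiaDegree y.1 = 1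

/-- A single closed point lies over `x`, and it is unramified. -/
def IsInert : Prop :=
  ∃ y : H.Fibre x, (∀ y' : H.Fibre x, y' = y) ∧ H.ramificationIndex y.1 = 1

open Classical in
/-- The quadratic character of the double cover. -/
def chi : ℤ := if H.IsRamified x then 0 else if H.IsSplit x then 1 else -1

/-! ## The local objects at `x` -/

/-- The submonoid `S_x = {a x}` of effective `0`-cycles on `ℙ¹` supported at `x`. -/
def _root_.HyperellipticIncidence.localS (x : ClosedPoint (P1 k)) :
    AddSubmonoid (EffZeroCycle (P1 k)) :=
  AddSubmonoid.multiples (Finsupp.single x 1)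

/-- The submonoid `T_x` of effective `0`-cycles on `C` lying over cycles in `S_x`. -/
def localT : AddSubmonoid (EffZeroCycle H.C) :=
  (localS x).comap (EffZeroCycle.pushforward H.π)

/-- The pushforward `π_* : T_x → S_x`. -/
def localPush (β : H.localT x) : localS x := ⟨EffZeroCycle.pushforward H.π β.1, β.2⟩

/-- The functor `π_* ζ_{C,x}` in the incidence algebra of `S_x`. -/
def pushZeta : LinFun (localS x) := (zeta (H.localT x)).pushforward (H.localPush x)

/-- The subset defining `L_x(C)⁺`: `{0}` if `x` is ramified, all of `S_x` if `x` is split, and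
`{2 n x}` if `x` is inert. -/
def setPlus : Set (localS x) :=
  {α | (H.IsRamified x ∧ α = 0) ∨ H.IsSplit x ∨
    (H.IsInert x ∧ ∃ n : ℕ, α.1 = Finsupp.single x (2 * n))}

/-- The subset defining `L_x(C)⁻`: empty if `x` is ramified or split, and `{(2 n + 1) x}` if `x`
is inert. -/
def setMinus : Set (localS x) :=
  {α | H.IsInert x ∧ ∃ n : ℕ, α.1 = Finsupp.single x (2 * n + 1)}

/-- The functor `L_x(C)⁺`. -/
def LPlus : LinFun (localS x) := LinFun.ofSet (H.setPlus x)

/-- The functor `L_x(C)⁻`. -/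
def LMinus : LinFun (localS x) := LinFun.ofSet (H.setMinus x)

/-! ## Generating functions and local factors -/

/-- The generating function `∑_α |F|(α) t^{deg α} = ∑_n |F|(n x) t^{n deg x}` of the cardinality
of `F`, i.e. the pushforward of `|F|` along the degree map. -/
def _root_.HyperellipticIncidence.genFun {x : ClosedPoint (P1 k)} (F : LinFun (localS x)) :
    PowerSeries ℤ :=
  PowerSeries.mk fun d =>
    ∑ᶠ α : {α : localS x // EffZeroCycle.degree (P1.toSpec k) α.1 = d}, (F.card α.1 : ℤ)

/-- The power series `1 / (1 - c t ^ d)`, for `d ≥ 1`. -/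
def _root_.HyperellipticIncidence.eulerFactor (c : ℤ) (d : ℕ) : PowerSeries ℤ :=
  PowerSeries.invOfUnit (1 - PowerSeries.C c * PowerSeries.X ^ d) 1

/-- `Z_x(ℙ¹, t) = 1 / (1 - t ^ deg x)`. -/
def _root_.HyperellipticIncidence.localZetaP1 (x : ClosedPoint (P1 k)) : PowerSeries ℤ :=
  eulerFactor 1 ((P1.toSpec k).residueDegree x.1)

/-- `Z_x(C, t) = ∏_{y ∈ π⁻¹(x)} 1 / (1 - t ^ deg y)`. -/
def localZeta : PowerSeries ℤ :=
  ∏ᶠ y : H.Fibre x, eulerFactor 1 (H.toSpec.residueDegree y.1.1)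

/-- `L_x(C, t) = 1 / (1 - χ(x) t ^ deg x)`. -/
def localL : PowerSeries ℤ :=
  eulerFactor (H.chi x) ((P1.toSpec k).residueDegree x.1)

end HyperellipticCurve

end

end HyperellipticIncidence

/-! ### Charts and irreducibility of the projective line. -/

namespace HyperellipticIncidence

open CategoryTheory AlgebraicGeometry

/-! The geometry enters only through the fundamental identity `∑ e(y|x) f(y|x) = 2` over `x`. To get
it, `π` is shown to be flat of constant rank 2. The standard charts of `ℙ¹` are spectra of principal
ideal domains. Since `C` is integral and `π` is finite and surjective, the coordinate rings over
these charts are torsion-free, hence flat. The rank is locally constant, `ℙ¹` is irreducible, and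
over the affine chart the ring `k[x][y]/(y² + hy - f)` is free of rank 2 (`finrank_π`). Comparing
stalks with localizations turns this rank into the sum of the `e f`
(`sum_ramificationIdxAt_mul_residueDegree`), and the ways to write 2 as such a sum are the three
splitting types (`fibre_trichotomy`).

The rest is counting. `S_x` is `ℕ`, and the fibre of `π_* ζ_{C,x}` over `n x` is the set of
solutions of `∑ c_y f(y|x) = n`. It has 1, `n + 1` or `[n even]` elements in the ramified, split and
inert case, that is, `∑_{m ≤ n} χ(x)^m` (`card_pushZeta_eq_sum`). Since `|L⁺| - |L⁻|` is `χ(x)^m` at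
`m x` and convolution with zeta takes partial sums, both sides of the equivalence have the same
cardinalities. All fibres being finite, bijections chosen fibre by fibre give the equivalence of
spans, and this induces the natural isomorphism.

The generating functions are power series in `T = t^{deg x}`, and the product formula is a case
check: `1/(1 - T)`, `1/(1 - T)²`, or `1/(1 - T²)`. -/

theorem _root_.MvPolynomial.IsHomogeneous.aeval_mul_left {σ R S : Type*} [CommSemiring R]
    [CommSemiring S] [Algebra R S] {p : MvPolynomial σ R} {n : ℕ} (hp : p.IsHomogeneous n)
    (c : S) (g : σ → S) :
    MvPolynomial.aeval (fun l => c * g l) p = c ^ n * MvPolynomial.aeval g p := by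
  rw [MvPolynomial.aeval_def, MvPolynomial.aeval_def, MvPolynomial.eval₂_eq,
    MvPolynomial.eval₂_eq, Finset.mul_sum]
  refine Finset.sum_congr rfl fun d hd => ?_
  rw [hp.degree_eq_sum_deg_support hd, Finset.prod_congr rfl fun l _ => mul_pow c (g l) (d l),
    Finset.prod_mul_distrib, Finset.prod_pow_eq_pow_sum]
  ring

noncomputable section

variable (k : Type u) [Field k]

/-- The standard chart ring `(k[X₀, X₁]_{Xᵢ})₀`. -/
abbrev ChartRing (i : Fin 2) : Type u :=
  HomogeneousLocalization.Away (grading k) (MvPolynomial.X i)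

theorem X_mem_grading (i : Fin 2) : MvPolynomial.X i ∈ grading k 1 :=
  MvPolynomial.isHomogeneous_X k i

/-- The coordinate `X_j / X_i`. -/
def chartCoord (i j : Fin 2) : ChartRing k i :=
  HomogeneousLocalization.Away.mk (grading k) (X_mem_grading k i) 1
    (MvPolynomial.X j) (X_mem_grading k j)

/-- The ring map `k[t] → (k[X₀, X₁]_{Xᵢ})₀` with `t ↦ X_j / X_i`. -/
def polyToChart (i j : Fin 2) : Polynomial k →+* ChartRing k i :=
  Polynomial.eval₂RingHom ((HomogeneousLocalization.fromZeroRingHom (grading k) _).comp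
    (algebraMap k (grading k 0))) (chartCoord k i j)

theorem val_polyToChart (i j : Fin 2) (q : Polynomial k) :
    (polyToChart k i j q).val = Polynomial.aeval (chartCoord k i j).val q := by
  have : (algebraMap (ChartRing k i) (Localization.Away (MvPolynomial.X i))).comp
      (polyToChart k i j) = (Polynomial.aeval (chartCoord k i j).val).toRingHom := by
    ext a
    · simp [polyToChart]
      rfl
    · simp [polyToChart]
  exact congr($this q)

/-- An element of the chart ring is `p / X_i^n` with `p` homogeneous of degree `n`. Its preimage is
the dehomogenization of `p`, because homogeneity lets the factor `X_i^n` be absorbed into the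
variables. -/
theorem polyToChart_surjective {i j : Fin 2} (hij : i ≠ j) :
    Function.Surjective (polyToChart k i j) := by
  intro z
  obtain ⟨n, p, hp, rfl⟩ :=
    HomogeneousLocalization.Away.mk_surjective (grading k) (X_mem_grading k i) z
  have hp' : p.IsHomogeneous n := by simpa using hp
  refine ⟨MvPolynomial.aeval (fun l => if l = i then 1 else Polynomial.X) p, ?_⟩
  apply HomogeneousLocalization.val_injective
  rw [val_polyToChart, HomogeneousLocalization.Away.val_mk]
  set L := Localization.Away (MvPolynomial.X i : MvPolynomial (Fin 2) k)
  have h1 : Polynomial.aeval (chartCoord k i j).val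
      (MvPolynomial.aeval (fun l => if l = i then (1 : Polynomial k) else Polynomial.X) p) =
      MvPolynomial.aeval (fun l => if l = i then 1 else (chartCoord k i j).val) p := by
    rw [← AlgHom.comp_apply, MvPolynomial.comp_aeval]
    congr 2
    ext l
    split_ifs <;> simp
  rw [h1, Localization.mk_eq_mk', IsLocalization.eq_mk'_iff_mul_eq]
  have h2 := hp'.aeval_mul_left (algebraMap (MvPolynomial (Fin 2) k) L (MvPolynomial.X i))
    (fun l => if l = i then 1 else (chartCoord k i j).val)
  simp only [map_pow]
  rw [mul_comm, ← h2]
  have h3 : (fun l => algebraMap (MvPolynomial (Fin 2) k) L (MvPolynomial.X i) *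
      (if l = i then 1 else (chartCoord k i j).val)) =
      fun l => algebraMap (MvPolynomial (Fin 2) k) L (MvPolynomial.X l) := by
    ext l
    by_cases hl : l = i
    · simp [hl]
    · obtain rfl : l = j := by omega
      rw [if_neg hl, chartCoord, HomogeneousLocalization.Away.val_mk, Localization.mk_eq_mk']
      simp only [pow_one]
      rw [mul_comm]
      exact IsLocalization.mk'_spec L _ _
  rw [h3]
  have h4 : (MvPolynomial.aeval fun l => algebraMap (MvPolynomial (Fin 2) k) L (MvPolynomial.X l)) =
      IsScalarTower.toAlgHom k (MvPolynomial (Fin 2) k) L := by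
    ext l
    simp
  rw [h4]
  rfl

theorem dehomogenize_comp_polyToChart :
    (P1.dehomogenize k).comp (polyToChart k 0 1) = RingHom.id _ := by
  have key (z : ChartRing k 0) : P1.dehomogenize k z = IsLocalization.Away.lift
      (S := Localization.Away (MvPolynomial.X 0 : MvPolynomial (Fin 2) k))
      (g := (MvPolynomial.aeval ![(1 : Polynomial k), Polynomial.X]).toRingHom)
      (MvPolynomial.X 0 : MvPolynomial (Fin 2) k) (by simp) z.val := rfl
  ext a
  · simp only [RingHom.comp_apply, key, val_polyToChart, RingHom.id_apply, Polynomial.aeval_C]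
    rw [IsScalarTower.algebraMap_apply k (MvPolynomial (Fin 2) k), IsLocalization.Away.lift_eq]
    simp
  · simp only [RingHom.comp_apply, key, val_polyToChart, RingHom.id_apply, Polynomial.aeval_X]
    have : (chartCoord k 0 1).val = IsLocalization.mk' _ (MvPolynomial.X 1)
        (⟨MvPolynomial.X 0 ^ 1, 1, rfl⟩ :
          Submonoid.powers (MvPolynomial.X 0 : MvPolynomial (Fin 2) k)) := by
      rw [chartCoord, HomogeneousLocalization.Away.val_mk, Localization.mk_eq_mk']
    -- The value at `X₁ / X₀` is forced by the relation `(X₁ / X₀) X₀ = X₁`, as `X₀ ↦ 1`.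
    have h := IsLocalization.mk'_spec (Localization.Away (MvPolynomial.X 0 : MvPolynomial (Fin 2) k))
      (MvPolynomial.X 1)
      (⟨MvPolynomial.X 0 ^ 1, 1, rfl⟩ :
          Submonoid.powers (MvPolynomial.X 0 : MvPolynomial (Fin 2) k))
    rw [← this] at h
    replace h := congrArg (IsLocalization.Away.lift
      (S := Localization.Away (MvPolynomial.X 0 : MvPolynomial (Fin 2) k))
      (g := (MvPolynomial.aeval ![(1 : Polynomial k), Polynomial.X]).toRingHom)
      (MvPolynomial.X 0 : MvPolynomial (Fin 2) k) (by simp)) h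
    rw [map_mul, IsLocalization.Away.lift_eq, IsLocalization.Away.lift_eq] at h
    simpa using congr(Polynomial.coeff $h a)

/-- A left inverse of a surjection is a two-sided inverse. -/
theorem dehomogenize_bijective : Function.Bijective (P1.dehomogenize k) := by
  have h := dehomogenize_comp_polyToChart k
  have hs := polyToChart_surjective k (i := 0) (j := 1) (by simp)
  constructor
  · intro a b hab
    obtain ⟨a, rfl⟩ := hs a
    obtain ⟨b, rfl⟩ := hs b
    have ha : _ = a := congr($h a)
    have hb : _ = b := congr($h b)
    simp only [RingHom.comp_apply] at ha hb
    rw [← ha, ← hb, hab]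
  · intro q
    exact ⟨polyToChart k 0 1 q, congr($h q)⟩

instance (i : Fin 2) : IsDomain (ChartRing k i) := by
  have : IsDomain (Localization.Away (MvPolynomial.X i : MvPolynomial (Fin 2) k)) :=
    IsLocalization.isDomain_localization
      (powers_le_nonZeroDivisors_of_noZeroDivisors (MvPolynomial.X_ne_zero i))
  exact Function.Injective.isDomain (algebraMap (ChartRing k i) (Localization.Away (MvPolynomial.X i)))
    (HomogeneousLocalization.val_injective _)

instance (i : Fin 2) : IsPrincipalIdealRing (ChartRing k i) :=
  -- In `Fin 2`, `1 - i` is the index other than `i`.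
  .of_surjective (polyToChart k i (1 - i)) (polyToChart_surjective k (by omega))

instance : IsOpenImmersion (P1.affineChart k) := by
  have : IsIso (CommRingCat.ofHom (P1.dehomogenize k)) :=
    (ConcreteCategory.isIso_iff_bijective _).mpr (dehomogenize_bijective k)
  exact @IsOpenImmersion.comp _ _ _ _ _ inferInstance
    (inferInstanceAs (IsOpenImmersion (Proj.awayι (grading k) _ (X_mem_grading k 0) _)))

/-- The chart `Spec (k[X₀, X₁]_{Xᵢ})₀ ⟶ ℙ¹`. -/
def chart (i : Fin 2) : Spec (.of (ChartRing k i)) ⟶ P1 k :=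
  Proj.awayι (grading k) (MvPolynomial.X i) (X_mem_grading k i) Nat.one_pos

instance (i : Fin 2) : IsOpenImmersion (chart k i) := by
  unfold chart; infer_instance

/-- The cover of `ℙ¹` by the standard charts. -/
def chartCover : (P1 k).AffineOpenCover :=
  Proj.affineOpenCoverOfIrrelevantLESpan (grading k) (fun i : Fin 2 => MvPolynomial.X i)
    (X_mem_grading k) (fun _ => Nat.one_pos) (by
      intro p hp
      -- No constant term means that every monomial of `p` is divisible by some variable.
      have h0 : MvPolynomial.homogeneousComponent 0 p = 0 := by
        have := (HomogeneousIdeal.mem_irrelevant_iff (grading k) p).mp hp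
        rw [GradedRing.proj_apply] at this
        exact (MvPolynomial.decomposition.decompose'_apply p 0).symm.trans this
      rw [MvPolynomial.homogeneousComponent_zero, MvPolynomial.C_eq_zero] at h0
      rw [← Set.image_univ, MvPolynomial.mem_ideal_span_X_image]
      intro m hm
      by_contra! h
      obtain rfl : m = 0 := Finsupp.ext fun i => h i trivial
      exact MvPolynomial.mem_support_iff.mp hm h0)

/-- The generic point of `ℙ¹`. -/
def P1.generic : P1 k where
  asHomogeneousIdeal := ⊥
  isPrime := by
    rw [HomogeneousIdeal.toIdeal_bot]
    exact Ideal.isPrime_bot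
  not_irrelevant_le h := by
    have : (MvPolynomial.X 0 : MvPolynomial (Fin 2) k) ∈ HomogeneousIdeal.irrelevant (grading k) :=
      HomogeneousIdeal.mem_irrelevant_of_mem _ Nat.one_pos (X_mem_grading k 0)
    exact MvPolynomial.X_ne_zero (R := k) (0 : Fin 2) (h this)

theorem P1.closure_generic : closure {P1.generic k} = Set.univ :=
  Set.eq_univ_of_forall fun x => (ProjectiveSpectrum.le_iff_mem_closure (grading k) _ _).mp
    (bot_le (a := (show ProjectiveSpectrum (grading k) from x).asHomogeneousIdeal))

/-- Used twice: the affine chart is dense, and a locally constant rank is constant. -/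
instance : IrreducibleSpace (P1 k) where
  isPreirreducible_univ := by
    rw [← P1.closure_generic k]
    exact isPreirreducible_singleton.closure
  toNonempty := ⟨P1.generic k⟩

end

end HyperellipticIncidence

/-! ### The double cover is finite flat of rank 2. -/

namespace HyperellipticIncidence

open CategoryTheory AlgebraicGeometry Limits

noncomputable section

instance isZariskiLocalAtTarget_flat :
    IsZariskiLocalAtTarget (@AlgebraicGeometry.Flat.{u}) :=
  HasRingHomProperty.instIsZariskiLocalAtTarget _ (Q := RingHom.Flat)

instance isZariskiLocalAtTarget_locallyOfFinitePresentation :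
    IsZariskiLocalAtTarget (@LocallyOfFinitePresentation.{u}) :=
  HasRingHomProperty.instIsZariskiLocalAtTarget _ (Q := RingHom.FinitePresentation)

instance respectsIso_flat : MorphismProperty.RespectsIso (@AlgebraicGeometry.Flat.{u}) :=
  isZariskiLocalAtTarget_flat.toRespects

instance respectsIso_locallyOfFinitePresentation :
    MorphismProperty.RespectsIso (@LocallyOfFinitePresentation.{u}) :=
  isZariskiLocalAtTarget_locallyOfFinitePresentation.toRespects

/-- Surjectivity makes the ring map injective, so the target domain is torsion-free, and
torsion-free over a principal ideal domain means flat. Finite presentation follows from finite type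
over a Noetherian ring. -/
theorem flat_and_locallyOfFinitePresentation_of_isPrincipalIdealRing {R : CommRingCat.{u}}
    [IsDomain R] [IsPrincipalIdealRing R] {X : Scheme.{u}} [IsIntegral X] (f : X ⟶ Spec R)
    [IsFinite f] [Surjective f] : Flat f ∧ LocallyOfFinitePresentation f := by
  wlog hX : ∃ S, X = Spec S with ih
  · have : IsAffine X := isAffine_of_isAffineHom f
    have : IsIntegral (Spec Γ(X, ⊤)) := isIntegral_of_isOpenImmersion X.isoSpec.inv
    rw [← MorphismProperty.cancel_left_of_respectsIso @AlgebraicGeometry.Flat X.isoSpec.inv,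
      ← MorphismProperty.cancel_left_of_respectsIso @LocallyOfFinitePresentation X.isoSpec.inv]
    exact ih _ ⟨_, rfl⟩
  obtain ⟨S, rfl⟩ := hX
  obtain ⟨φ, rfl⟩ := Spec.map_surjective f
  have hS : IsDomain S := (affine_isIntegral_iff S).mp inferInstance
  have hfin : φ.hom.Finite := (IsFinite.SpecMap_iff φ).mp ‹_›
  have hinj : Function.Injective φ.hom := by
    rw [injective_iff_map_eq_zero]
    intro a ha
    -- A prime over the generic point contains the kernel, so the kernel is zero.
    obtain ⟨q, hq⟩ := (Spec.map φ).surjective (⊥ : PrimeSpectrum R)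
    have : a ∈ (Spec.map φ q).asIdeal := by
      change φ.hom a ∈ q.asIdeal
      rw [ha]; exact zero_mem _
    rw [hq] at this
    simpa using this
  rw [Flat.SpecMap_iff, LocallyOfFinitePresentation.SpecMap_iff]
  algebraize [φ.hom]
  have : FaithfulSMul R S := (faithfulSMul_iff_algebraMap_injective R S).mpr hinj
  constructor
  · have : Module.IsTorsionFree R S := inferInstance
    change Module.Flat R S
    infer_instance
  · have : IsNoetherianRing R := inferInstance
    have hS : Algebra.FiniteType R S := inferInstance
    change Algebra.FinitePresentation R S
    exact Algebra.FinitePresentation.of_finiteType.mp hS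

variable {k : Type u} [Field k] (H : HyperellipticCurve k)

namespace HyperellipticCurve

instance : IsIntegral H.C :=
  have : Subsingleton (Spec (.of k)) := inferInstanceAs (Subsingleton (PrimeSpectrum k))
  GeometricallyIntegral.isIntegral_of_subsingleton (f := H.toSpec)

theorem monic_equation (f h : Polynomial k) : (Polynomial.X ^ 2 + Polynomial.C h * Polynomial.X -
    Polynomial.C f : Polynomial (Polynomial k)).Monic := by
  rw [sub_eq_add_neg, ← Polynomial.C_neg]
  monicity!

theorem natDegree_equation (f h : Polynomial k) : (Polynomial.X ^ 2 + Polynomial.C h * Polynomial.X -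
    Polynomial.C f : Polynomial (Polynomial k)).natDegree = 2 := by
  rw [sub_eq_add_neg, ← Polynomial.C_neg]
  compute_degree!

instance (f h : Polynomial k) : Module.Free (Polynomial k) (AffineRing f h) :=
  (monic_equation f h).free_adjoinRoot

instance (f h : Polynomial k) : Module.Finite (Polynomial k) (AffineRing f h) :=
  (monic_equation f h).finite_adjoinRoot

theorem finrank_affineRing (f h : Polynomial k) :
    Module.finrank (Polynomial k) (AffineRing f h) = 2 := by
  rw [(AdjoinRoot.powerBasis' (monic_equation f h)).finrank, AdjoinRoot.powerBasis'_dim,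
    natDegree_equation]

instance (f h : Polynomial k) : Surjective (affineProj f h) := by
  have : Nontrivial (AffineRing f h) :=
    Module.nontrivial_of_finrank_pos (R := Polynomial k) (by rw [finrank_affineRing]; simp)
  exact ⟨PrimeSpectrum.comap_surjective_of_faithfullyFlat (A := Polynomial k)⟩

/-- The image is closed and contains the dense affine chart. -/
instance : Surjective H.π := by
  obtain ⟨c, hc⟩ := H.hasAffineEquation
  have hsub : Set.range (P1.affineChart k) ⊆ Set.range H.π := by
    rintro _ ⟨a, rfl⟩
    obtain ⟨b, rfl⟩ := (affineProj H.f H.h).surjective a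
    exact ⟨c b, by rw [← Scheme.Hom.comp_apply, hc.w, Scheme.Hom.comp_apply]⟩
  have hdense : Dense (Set.range (P1.affineChart k)) :=
    (P1.affineChart k).isOpenEmbedding.isOpen_range.dense
      ⟨_, (⊥ : PrimeSpectrum (Polynomial k)), rfl⟩
  refine ⟨Set.range_eq_univ.mp ?_⟩
  rw [← H.π.isClosedMap.isClosed_range.closure_eq]
  exact (hdense.mono hsub).closure_eq

theorem flat_and_locallyOfFinitePresentation : Flat H.π ∧ LocallyOfFinitePresentation H.π := by
  have key (i : Fin 2) : Flat (pullback.snd H.π (chart k i)) ∧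
      LocallyOfFinitePresentation (pullback.snd H.π (chart k i)) := by
    have : Nonempty ↑(pullback H.π (chart k i)) := by
      have : Nonempty (Spec (.of (ChartRing k i))) :=
        inferInstanceAs (Nonempty (PrimeSpectrum (ChartRing k i)))
      obtain ⟨a⟩ := this
      exact ⟨((pullback.snd H.π (chart k i)).surjective a).choose⟩
    have : IsIntegral (pullback H.π (chart k i)) :=
      isIntegral_of_isOpenImmersion (pullback.fst H.π (chart k i))
    have : IsDomain (CommRingCat.of (ChartRing k i)) := inferInstanceAs (IsDomain (ChartRing k i))
    have : IsPrincipalIdealRing (CommRingCat.of (ChartRing k i)) :=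
      inferInstanceAs (IsPrincipalIdealRing (ChartRing k i))
    exact flat_and_locallyOfFinitePresentation_of_isPrincipalIdealRing _
  rw [IsZariskiLocalAtTarget.iff_of_openCover (P := @AlgebraicGeometry.Flat) (chartCover k).openCover,
    IsZariskiLocalAtTarget.iff_of_openCover (P := @LocallyOfFinitePresentation)
    (chartCover k).openCover]
  exact ⟨fun i => (key i).1, fun i => (key i).2⟩

instance : Flat H.π := H.flat_and_locallyOfFinitePresentation.1

instance : LocallyOfFinitePresentation H.π := H.flat_and_locallyOfFinitePresentation.2

/-- A constant rank can be read off at any one point; the generic point of the affine chart is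
taken, where the equation gives a free module. -/
theorem finrank_π (x : P1 k) : H.π.finrank x = 2 := by
  obtain ⟨c, hc⟩ := H.hasAffineEquation
  have h := (H.π.isLocallyConstant_finrank).apply_eq_of_preconnectedSpace x
    (P1.affineChart k (⊥ : PrimeSpectrum (Polynomial k)))
  rw [h]
  refine (Scheme.Hom.finrank_of_isPullback _ _ _ _ hc _).symm.trans ?_
  refine (Scheme.Hom.finrank_SpecMap_algebraMap _ _ _).trans ?_
  rw [Module.rankAtStalk_eq_finrank_of_free]
  exact finrank_affineRing _ _

end HyperellipticCurve

end

end HyperellipticIncidence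

/-! ### The fundamental identity for a finite flat morphism. -/

namespace HyperellipticIncidence

open CategoryTheory AlgebraicGeometry Limits

section Localization

open IsLocalRing

variable {A : Type*} [CommRing A] (p : Ideal A) [p.IsPrime]
  (Ap : Type*) [CommRing Ap] [IsLocalRing Ap] [Algebra A Ap] [IsLocalization.AtPrime Ap p]

include p in
-- Localizations are formally unramified.
theorem ramificationIdx_maximalIdeal_localization :
    (maximalIdeal Ap).ramificationIdx A = 1 := by
  have : Algebra.FormallyUnramified A Ap := .of_isLocalization p.primeCompl
  have : Algebra.EssFiniteType A Ap := .of_isLocalization Ap p.primeCompl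
  have : Algebra.FormallyUnramified Ap (Localization.AtPrime (maximalIdeal Ap)) :=
    .of_isLocalization (maximalIdeal Ap).primeCompl
  have : Algebra.IsUnramifiedAt A (maximalIdeal Ap) :=
    Algebra.FormallyUnramified.comp A Ap _
  exact Ideal.ramificationIdx_eq_one _ _

theorem inertiaDeg_maximalIdeal_localization [p.IsMaximal] :
    (maximalIdeal Ap).inertiaDeg A = 1 := by
  have : (maximalIdeal Ap).LiesOver p :=
    ⟨(IsLocalization.AtPrime.under_maximalIdeal Ap p).symm⟩
  rw [Ideal.inertiaDeg_eq_of_isMaximal p]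
  have hb : Function.Bijective (algebraMap (A ⧸ p) (Ap ⧸ maximalIdeal Ap)) := by
    convert (IsLocalization.AtPrime.equivQuotMaximalIdeal p Ap).bijective
    ext x
    obtain ⟨x, rfl⟩ := Ideal.Quotient.mk_surjective x
    rfl
  let := Ideal.Quotient.field p
  rw [← (LinearEquiv.ofBijective (Algebra.linearMap (A ⧸ p) (Ap ⧸ maximalIdeal Ap)) hb).finrank_eq]
  exact Module.finrank_self _

variable {B : Type*} [CommRing B] (q : Ideal B) [q.IsPrime] [Algebra A B]
  (Bq : Type*) [CommRing Bq] [IsLocalRing Bq] [Algebra B Bq] [IsLocalization.AtPrime Bq q]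
  [Algebra Ap Bq] [Algebra A Bq] [IsScalarTower A B Bq] [IsScalarTower A Ap Bq]
  [IsLocalHom (algebraMap Ap Bq)]

include p q in
-- Multiplicativity of `e` in the two towers `A → B → B_q` and `A → A_p → B_q`, both with flat upper
-- step; the localizations contribute 1.
theorem ramificationIdx_localization [Module.Flat Ap Bq] :
    (maximalIdeal Bq).ramificationIdx Ap = q.ramificationIdx A := by
  have : (maximalIdeal Bq).LiesOver q := ⟨(IsLocalization.AtPrime.under_maximalIdeal Bq q).symm⟩
  have : Module.Flat B Bq := IsLocalization.flat Bq q.primeCompl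
  have h1 := Ideal.ramificationIdx_tower (R := A) q (maximalIdeal Bq)
  have h2 := Ideal.ramificationIdx_tower (R := A) (maximalIdeal Ap) (maximalIdeal Bq)
  rw [ramificationIdx_maximalIdeal_localization q Bq, mul_one] at h1
  rw [ramificationIdx_maximalIdeal_localization p Ap, one_mul] at h2
  rw [← h2, h1]

include p q in
theorem finrank_residueField_localization [p.IsMaximal] [q.IsMaximal] :
    Module.finrank (ResidueField Ap) (ResidueField Bq) = q.inertiaDeg A := by
  have : (maximalIdeal Bq).LiesOver q := ⟨(IsLocalization.AtPrime.under_maximalIdeal Bq q).symm⟩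
  have h1 := Ideal.inertiaDeg_tower (R := A) q (maximalIdeal Bq)
  have h2 := Ideal.inertiaDeg_tower (R := A) (maximalIdeal Ap) (maximalIdeal Bq)
  rw [inertiaDeg_maximalIdeal_localization q Bq, mul_one] at h1
  rw [inertiaDeg_maximalIdeal_localization p Ap, one_mul] at h2
  rw [← h1, h2, Ideal.inertiaDeg_eq_of_isMaximal (maximalIdeal Ap)]
  rfl

end Localization

noncomputable section

variable {X Y : Scheme.{u}} (f : X ⟶ Y) [IsFinite f] {U : Y.Opens} (hU : IsAffineOpen U)

include hU in
-- Over `U` the morphism is `Spec` of a finite flat ring map, the rank is stable under base change,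
-- and the rank at a prime is the dimension of the fibre there.
theorem finrank_eq_finrank_fiber [Flat f] (y : Y) (hy : y ∈ U) :
    letI := (f.app U).hom.toAlgebra
    f.finrank y = Module.finrank (hU.primeIdealOf ⟨y, hy⟩).asIdeal.ResidueField
      ((hU.primeIdealOf ⟨y, hy⟩).asIdeal.Fiber Γ(X, f ⁻¹ᵁ U)) := by
  have hV : IsAffineOpen (f ⁻¹ᵁ U) := hU.preimage f
  have hpb : IsPullback hV.fromSpec (Spec.map (f.app U)) f hU.fromSpec := by
    rw [Scheme.Hom.app_eq_appLE]
    refine (IsOpenImmersion.isPullback _ _ _ _ ?_ ?_).flip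
    · exact (hU.SpecMap_appLE_fromSpec f hV le_rfl).symm
    · rw [hU.opensRange_fromSpec, hV.opensRange_fromSpec]
  let := (f.app U).hom.toAlgebra
  have hfin : (f.app U).hom.Finite := f.finite_app U hU
  have hflat : (f.app U).hom.Flat := by
    rw [Scheme.Hom.app_eq_appLE]
    exact f.flat_appLE hU hV le_rfl
  have : Module.Finite Γ(Y, U) Γ(X, f ⁻¹ᵁ U) := hfin
  have : Module.Flat Γ(Y, U) Γ(X, f ⁻¹ᵁ U) := hflat
  rw [Ideal.finrank_fiber_eq_rankAtStalk]
  have h := Scheme.Hom.finrank_of_isPullback _ _ _ _ hpb (hU.primeIdealOf ⟨y, hy⟩)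
  rw [hU.fromSpec_primeIdealOf] at h
  rw [← h]
  exact Scheme.Hom.finrank_SpecMap_algebraMap _ _ _

/-- The points over `y` correspond to the primes over the prime ideal of `y` in an affine chart. -/
def preimageEquivPrimesOver (y : Y) (hy : y ∈ U) :
    letI := (f.app U).hom.toAlgebra
    {x : X // f x = y} ≃ (hU.primeIdealOf ⟨y, hy⟩).asIdeal.primesOver Γ(X, f ⁻¹ᵁ U) :=
  letI := (f.app U).hom.toAlgebra
  have hV : IsAffineOpen (f ⁻¹ᵁ U) := hU.preimage f
  have hmem (x : {x : X // f x = y}) : x.1 ∈ f ⁻¹ᵁ U := by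
    change f x.1 ∈ U
    rw [x.2]; exact hy
  have hcomm (q : Spec Γ(X, f ⁻¹ᵁ U)) :
      f (hV.fromSpec q) = hU.fromSpec (Spec.map (f.app U) q) := by
    rw [← Scheme.Hom.comp_apply, ← hU.SpecMap_appLE_fromSpec f hV le_rfl, Scheme.Hom.comp_apply,
      ← Scheme.Hom.app_eq_appLE]
  { toFun x := ⟨(hV.primeIdealOf ⟨x.1, hmem x⟩).asIdeal, (hV.primeIdealOf ⟨x.1, hmem x⟩).2, ⟨by
      have h := congrArg PrimeSpectrum.asIdeal
        (IsAffineOpen.comap_primeIdealOf_appLE (f := f) U hU _ hV le_rfl (hmem x))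
      rw [← Scheme.Hom.app_eq_appLE] at h
      obtain ⟨x, rfl⟩ := x
      exact h.symm⟩⟩
    invFun q := ⟨hV.fromSpec ⟨q.1, q.2.1⟩, by
      have h : Spec.map (f.app U) ⟨q.1, q.2.1⟩ = hU.primeIdealOf ⟨y, hy⟩ :=
        PrimeSpectrum.ext q.2.2.over.symm
      exact (hcomm _).trans ((congrArg hU.fromSpec h).trans (hU.fromSpec_primeIdealOf _))⟩
    left_inv x := Subtype.ext (hV.fromSpec_primeIdealOf _)
    right_inv q := by
      apply Subtype.ext
      exact congrArg PrimeSpectrum.asIdeal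
        (hV.fromSpec.isOpenEmbedding.injective (hV.fromSpec_primeIdealOf _) :
          hV.primeIdealOf _ = (⟨q.1, q.2.1⟩ : PrimeSpectrum Γ(X, f ⁻¹ᵁ U))) }

/-- The ramification index of a morphism at a point. -/
def ramificationIdxAt (f : X ⟶ Y) (x : X) : ℕ :=
  letI := (f.stalkMap x).hom.toAlgebra
  (IsLocalRing.maximalIdeal (X.presheaf.stalk x)).ramificationIdx (Y.presheaf.stalk (f x))

/-- Both stalks are localizations of the section rings, at primes that are maximal because the
points are closed, so `e` and `f` may be computed before localizing. -/
theorem ramificationIdxAt_mul_residueDegree [Flat f] (y : Y) (hy : y ∈ U) (hyc : IsClosed {y})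
    (x : {x : X // f x = y}) :
    letI := (f.app U).hom.toAlgebra
    ramificationIdxAt f x.1 * f.residueDegree x.1 =
      (preimageEquivPrimesOver f hU y hy x).1.ramificationIdx Γ(Y, U) *
        (preimageEquivPrimesOver f hU y hy x).1.inertiaDeg Γ(Y, U) := by
  obtain ⟨x, rfl⟩ := x
  let := (f.app U).hom.toAlgebra
  have hV : IsAffineOpen (f ⁻¹ᵁ U) := hU.preimage f
  set p := hU.primeIdealOf ⟨f x, hy⟩ with hp
  set q := (preimageEquivPrimesOver f hU (f x) hy ⟨x, rfl⟩).1 with hq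
  have hq' : q = (hV.primeIdealOf ⟨x, hy⟩).asIdeal := rfl
  have : p.asIdeal.IsMaximal := hU.primeIdealOf_isMaximal_of_isClosed _ hyc
  let := Y.presheaf.algebra_section_stalk ⟨f x, hy⟩
  have : IsLocalization.AtPrime (Y.presheaf.stalk (f x)) p.asIdeal :=
    hU.isLocalization_stalk ⟨f x, hy⟩
  let := X.presheaf.algebra_section_stalk (U := f ⁻¹ᵁ U) ⟨x, hy⟩
  have hqp : q.IsPrime := (preimageEquivPrimesOver f hU (f x) hy ⟨x, rfl⟩).2.1
  have hqover : q.LiesOver p.asIdeal := (preimageEquivPrimesOver f hU (f x) hy ⟨x, rfl⟩).2.2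
  have : Module.Finite Γ(Y, U) Γ(X, f ⁻¹ᵁ U) := f.finite_app U hU
  have : q.IsMaximal := Ideal.IsMaximal.of_liesOver_isMaximal q p.asIdeal
  have : IsLocalization.AtPrime (X.presheaf.stalk x) q :=
    hV.isLocalization_stalk ⟨x, hy⟩
  let := (f.stalkMap x).hom.toAlgebra
  let : Algebra Γ(Y, U) (X.presheaf.stalk x) :=
    ((algebraMap Γ(X, f ⁻¹ᵁ U) (X.presheaf.stalk x)).comp
      (algebraMap Γ(Y, U) Γ(X, f ⁻¹ᵁ U))).toAlgebra
  have : IsScalarTower Γ(Y, U) Γ(X, f ⁻¹ᵁ U) (X.presheaf.stalk x) := .of_algebraMap_eq' rfl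
  have : IsScalarTower Γ(Y, U) (Y.presheaf.stalk (f x)) (X.presheaf.stalk x) :=
    .of_algebraMap_eq' (congrArg CommRingCat.Hom.hom (f.germ_stalkMap U x hy)).symm
  have : IsLocalHom (algebraMap (Y.presheaf.stalk (f x)) (X.presheaf.stalk x)) :=
    inferInstanceAs (IsLocalHom (f.stalkMap x).hom)
  have : Module.Flat (Y.presheaf.stalk (f x)) (X.presheaf.stalk x) := Flat.stalkMap f x
  rw [← ramificationIdx_localization p.asIdeal (Y.presheaf.stalk (f x)) q (X.presheaf.stalk x),
    ← finrank_residueField_localization p.asIdeal (Y.presheaf.stalk (f x)) q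
      (X.presheaf.stalk x)]
  congr 1
  unfold Scheme.Hom.residueDegree
  let := (f.residueFieldMap x).hom.toAlgebra
  exact Algebra.finrank_eq_of_equiv_equiv (.refl _) (.refl _) rfl

include hU in
theorem ramificationIdxAt_mul_residueDegree_pos [Flat f] (x : X) (hx : f x ∈ U)
    (hxc : IsClosed {f x}) : 0 < ramificationIdxAt f x * f.residueDegree x := by
  let := (f.app U).hom.toAlgebra
  have : Module.Finite Γ(Y, U) Γ(X, f ⁻¹ᵁ U) := f.finite_app U hU
  have : (preimageEquivPrimesOver f hU (f x) hx ⟨x, rfl⟩).1.IsPrime :=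
    (preimageEquivPrimesOver f hU (f x) hx ⟨x, rfl⟩).2.1
  refine (Nat.mul_pos ?_ ?_).trans_eq
    (ramificationIdxAt_mul_residueDegree f hU (f x) hx hxc ⟨x, rfl⟩).symm
  · exact Ideal.ramificationIdx_pos _ _
  · exact Ideal.inertiaDeg_pos _ _

include hU in
theorem sum_ramificationIdxAt_mul_residueDegree [Flat f] (y : Y) (hy : y ∈ U) (hyc : IsClosed {y})
    [Fintype {x : X // f x = y}] :
    ∑ x : {x : X // f x = y}, ramificationIdxAt f x.1 * f.residueDegree x.1 = f.finrank y := by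
  let := (f.app U).hom.toAlgebra
  let e := preimageEquivPrimesOver f hU y hy
  let := Fintype.ofEquiv _ e
  have hfin : (f.app U).hom.Finite := f.finite_app U hU
  have : Module.Finite Γ(Y, U) Γ(X, f ⁻¹ᵁ U) := hfin
  rw [finrank_eq_finrank_fiber f hU y hy, ← Ideal.sum_ramification_inertia_eq_finrank_fiber,
    ← e.sum_comp]
  exact Finset.sum_congr rfl fun x _ => ramificationIdxAt_mul_residueDegree f hU y hy hyc x

end

end HyperellipticIncidence

/-! ### Residue degrees and the three types of fibre. -/

namespace HyperellipticIncidence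

open CategoryTheory AlgebraicGeometry Limits

noncomputable section

theorem residueDegree_comp {X Y Z : Scheme.{u}} (f : X ⟶ Y) (g : Y ⟶ Z) (x : X) :
    (f ≫ g).residueDegree x = g.residueDegree (f x) * f.residueDegree x := by
  unfold Scheme.Hom.residueDegree
  let := (f.residueFieldMap x).hom.toAlgebra
  let := (g.residueFieldMap (f x)).hom.toAlgebra
  let := ((f ≫ g).residueFieldMap x).hom.toAlgebra
  let : Algebra (Z.residueField (g (f x))) (X.residueField x) :=
    inferInstanceAs (Algebra (Z.residueField ((f ≫ g) x)) (X.residueField x))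
  have : IsScalarTower (Z.residueField (g (f x))) (Y.residueField (f x)) (X.residueField x) :=
    .of_algebraMap_eq' (congrArg CommRingCat.Hom.hom (Scheme.residueFieldMap_comp f g x))
  exact (Module.finrank_mul_finrank (Z.residueField (g (f x))) (Y.residueField (f x))
    (X.residueField x)).symm

/-- `Module.finrank` is 0 for infinite extensions, so the content is finiteness of the residue
extension. This is the Nullstellensatz: `Spec κ(x) → Y` is of finite type over a Jacobson space,
hence finite. -/
theorem residueDegree_pos_of_isClosed {X Y : Scheme.{u}} (f : X ⟶ Y) [LocallyOfFiniteType f]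
    [JacobsonSpace Y] {x : X} (hx : IsClosed {x}) : 0 < f.residueDegree x := by
  have : IsClosedImmersion (X.fromSpecResidueField x) :=
    isClosed_singleton_iff_isClosedImmersion.mp hx
  have h1 : IsFinite (X.fromSpecResidueField x ≫ f) :=
    isFinite_iff_locallyOfFiniteType_of_jacobsonSpace.mpr inferInstance
  rw [← Scheme.Hom.SpecMap_residueFieldMap_fromSpecResidueField] at h1
  have h2 : IsFinite (Spec.map (f.residueFieldMap x)) := IsFinite.of_comp _ (Y.fromSpecResidueField _)
  rw [IsFinite.SpecMap_iff] at h2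
  unfold Scheme.Hom.residueDegree
  let := (f.residueFieldMap x).hom.toAlgebra
  have : Module.Finite (Y.residueField (f x)) (X.residueField x) := h2
  exact Module.finrank_pos

variable {k : Type u} [Field k]

instance : LocallyOfFiniteType (P1.toSpec k) := by
  have h0 : Function.Surjective (algebraMap k (grading k 0)) := by
    rintro ⟨p, hp⟩
    have hp' : p ∈ (1 : Submodule k (MvPolynomial (Fin 2) k)) := by
      rw [← MvPolynomial.homogeneousSubmodule_zero]; exact hp
    obtain ⟨c, hc⟩ := Submodule.mem_one.mp hp'
    exact ⟨c, Subtype.ext hc⟩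
  have h1 : LocallyOfFiniteType (Spec.map (CommRingCat.ofHom (algebraMap k (grading k 0)))) := by
    rw [HasRingHomProperty.Spec_iff (P := @LocallyOfFiniteType)]
    exact RingHom.FiniteType.of_surjective _ h0
  have : IsScalarTower k (grading k 0) (MvPolynomial (Fin 2) k) :=
    ⟨fun a b c => smul_mul_assoc a b.1 c⟩
  have h2 : Algebra.FiniteType (grading k 0) (MvPolynomial (Fin 2) k) :=
    .of_restrictScalars_finiteType k _ _
  unfold P1.toSpec
  infer_instance

theorem degree_pos (x : ClosedPoint (P1 k)) : 0 < (P1.toSpec k).residueDegree x.1 := by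
  have : JacobsonSpace (Spec (.of k)) := inferInstanceAs (JacobsonSpace (PrimeSpectrum k))
  exact residueDegree_pos_of_isClosed _ x.2

namespace HyperellipticCurve

variable (H : HyperellipticCurve k) (x : ClosedPoint (P1 k))

theorem residueDegree_fibre (y : H.Fibre x) : H.toSpec.residueDegree y.1.1 =
    (P1.toSpec k).residueDegree x.1 * H.inertiaDegree y.1 := by
  obtain ⟨y, rfl⟩ := y
  exact residueDegree_comp _ _ _

theorem finite_preimage : Finite {c : H.C // H.π c = x.1} :=
  (H.π.finite_preimage_singleton x.1).to_subtype

/-- All points over a closed point are closed. -/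
def fibreEquiv : H.Fibre x ≃ {c : H.C // H.π c = x.1} where
  toFun y := ⟨y.1.1, congrArg Subtype.val y.2⟩
  invFun c := ⟨⟨c.1, by
    obtain ⟨c, hc⟩ := c
    have hZ : IsClosed (H.π ⁻¹' {x.1}) := IsClosed.preimage H.π.continuous x.2
    -- The fibre is closed and, `π` being finite, discrete; so each of its points is closed in `C`.
    have := (H.π.isDiscrete_preimage_singleton x.1).to_subtype
    have h := hZ.isClosedEmbedding_subtypeVal.isClosedMap _
      (isClosed_discrete {(⟨c, hc⟩ : H.π ⁻¹' {x.1})})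
    rwa [Set.image_singleton] at h⟩, Subtype.ext c.2⟩
  left_inv _ := rfl
  right_inv _ := rfl

instance : Finite (H.Fibre x) :=
  have := H.finite_preimage x
  .of_equiv _ (H.fibreEquiv x).symm

theorem sum_ramificationIndex_mul_inertiaDegree [Fintype (H.Fibre x)] :
    ∑ y : H.Fibre x, H.ramificationIndex y.1 * H.inertiaDegree y.1 = 2 := by
  obtain ⟨U, hU, hx, -⟩ := exists_isAffineOpen_mem_and_subset (x := x.1) (U := ⊤) trivial
  let := Fintype.ofEquiv _ (H.fibreEquiv x)
  rw [← H.finrank_π x.1, ← sum_ramificationIdxAt_mul_residueDegree H.π hU x.1 hx x.2,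
    ← (H.fibreEquiv x).sum_comp]
  rfl

theorem ramificationIndex_mul_inertiaDegree_pos (y : H.Fibre x) :
    0 < H.ramificationIndex y.1 * H.inertiaDegree y.1 := by
  obtain ⟨U, hU, hx, -⟩ := exists_isAffineOpen_mem_and_subset (x := H.π y.1.1) (U := ⊤) trivial
  exact ramificationIdxAt_mul_residueDegree_pos H.π hU y.1.1 hx (ClosedPoint.map H.π y.1).2

theorem inertiaDegree_pos (y : H.Fibre x) : 0 < H.inertiaDegree y.1 :=
  Nat.pos_of_mul_pos_left (H.ramificationIndex_mul_inertiaDegree_pos x y)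

/-- The three possible shapes of a fibre of the double cover. -/
theorem fibre_trichotomy :
    (∃ y : H.Fibre x, (∀ y', y' = y) ∧ H.ramificationIndex y.1 = 2 ∧ H.inertiaDegree y.1 = 1) ∨
    (∃ y₁ y₂ : H.Fibre x, y₁ ≠ y₂ ∧ (∀ y', y' = y₁ ∨ y' = y₂) ∧
      ∀ y' : H.Fibre x, H.ramificationIndex y'.1 = 1 ∧ H.inertiaDegree y'.1 = 1) ∨
    (∃ y : H.Fibre x, (∀ y', y' = y) ∧ H.ramificationIndex y.1 = 1 ∧ H.inertiaDegree y.1 = 2) := by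
  classical
  let := Fintype.ofFinite (H.Fibre x)
  have hsum := H.sum_ramificationIndex_mul_inertiaDegree x
  have hpos := H.ramificationIndex_mul_inertiaDegree_pos x
  -- Every point contributes at least 1 to a sum equal to 2.
  have hcard : Fintype.card (H.Fibre x) ≤ 2 := by
    rw [← hsum, ← Finset.card_univ, Finset.card_eq_sum_ones]
    exact Finset.sum_le_sum fun y _ => hpos y
  have hne : Fintype.card (H.Fibre x) ≠ 0 := by
    intro h
    have := Fintype.card_eq_zero_iff.mp h
    simp at hsum
  obtain h | h : Fintype.card (H.Fibre x) = 1 ∨ Fintype.card (H.Fibre x) = 2 := by omega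
  · obtain ⟨y, hy⟩ := Fintype.card_eq_one_iff.mp h
    let : Unique (H.Fibre x) := ⟨⟨y⟩, hy⟩
    rw [Fintype.sum_unique] at hsum
    change H.ramificationIndex y.1 * H.inertiaDegree y.1 = 2 at hsum
    rcases (Nat.dvd_prime Nat.prime_two).mp (Dvd.intro _ hsum) with h1 | h2
    · rw [h1, one_mul] at hsum
      exact Or.inr (Or.inr ⟨y, hy, h1, hsum⟩)
    · refine Or.inl ⟨y, hy, h2, ?_⟩
      rw [h2] at hsum
      omega
  · refine Or.inr (Or.inl ?_)
    obtain ⟨y₁, y₂, hne, huniv⟩ := Finset.card_eq_two.mp (Finset.card_univ.trans h)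
    refine ⟨y₁, y₂, hne, fun y' => by simpa [huniv] using Finset.mem_univ y', fun y' => ?_⟩
    rw [huniv, Finset.sum_pair hne] at hsum
    have h1 := hpos y₁
    have h2 := hpos y₂
    have hy' : H.ramificationIndex y'.1 * H.inertiaDegree y'.1 = 1 := by
      obtain rfl | rfl : y' = y₁ ∨ y' = y₂ := by simpa [huniv] using Finset.mem_univ y'
      all_goals omega
    exact ⟨Nat.eq_one_of_mul_eq_one_right hy', Nat.eq_one_of_mul_eq_one_left hy'⟩

end HyperellipticCurve

end

end HyperellipticIncidence

/-! ### Spans with finite fibres, convolution with zeta, Euler factors. -/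

namespace HyperellipticIncidence

open CategoryTheory AlgebraicGeometry Limits

noncomputable section

namespace LinFun

variable {B : Type u}

/-- The bijection acts on the apex coordinate and morphisms of `Set_{/B}` on the other, so
naturality is definitional. -/
theorem SpanEquiv.functorEquiv {F G : LinFun B} (h : F.SpanEquiv G) : F.FunctorEquiv G := by
  obtain ⟨φ, hφ⟩ := h
  refine ⟨NatIso.ofComponents (fun X => Equiv.toIso
    { toFun := fun p => ⟨(p.1.1, φ p.1.2), p.2.trans (hφ _).symm⟩
      invFun := fun p => ⟨(p.1.1, φ.symm p.1.2), p.2.trans (by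
        rw [← hφ, φ.apply_symm_apply])⟩
      left_inv := fun p => Subtype.ext (Prod.ext rfl (φ.symm_apply_apply _))
      right_inv := fun p => Subtype.ext (Prod.ext rfl (φ.apply_symm_apply _)) }) ?_⟩
  intro X Y f
  rfl

/-- Finite fibres of equal size are in bijection; the chosen bijections are glued over `B`.
Finiteness matters because `Nat.card` is 0 on infinite types. -/
theorem spanEquiv_of_card_eq {F G : LinFun B} (hF : F.LocallyFinite) (hG : G.LocallyFinite)
    (h : ∀ b, F.card b = G.card b) : F.SpanEquiv G := by
  have e (b : B) : {m : F.apex // F.leg m = b} ≃ {m : G.apex // G.leg m = b} :=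
    have := hF b
    have := hG b
    ((Finite.card_eq).mp (h b)).some
  exact ⟨(Equiv.sigmaFiberEquiv F.leg).symm.trans
    ((Equiv.sigmaCongrRight e).trans (Equiv.sigmaFiberEquiv G.leg)),
    fun m => (e (F.leg m) ⟨m, rfl⟩).2⟩

theorem LocallyFinite.add {F G : LinFun B} (hF : F.LocallyFinite) (hG : G.LocallyFinite) :
    (F.add G).LocallyFinite := fun b =>
  have : Finite {m // Sum.elim F.leg G.leg (Sum.inl m) = b} := hF b
  have : Finite {m // Sum.elim F.leg G.leg (Sum.inr m) = b} := hG b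
  .of_equiv _ (Equiv.subtypeSum (p := fun m : F.apex ⊕ G.apex => Sum.elim F.leg G.leg m = b)).symm

theorem card_add {F G : LinFun B} (hF : F.LocallyFinite) (hG : G.LocallyFinite) (b : B) :
    (F.add G).card b = F.card b + G.card b := by
  have : Finite {m // Sum.elim F.leg G.leg (Sum.inl m) = b} := hF b
  have : Finite {m // Sum.elim F.leg G.leg (Sum.inr m) = b} := hG b
  exact (Nat.card_congr
    (Equiv.subtypeSum (p := fun m : F.apex ⊕ G.apex => Sum.elim F.leg G.leg m = b))).trans
    Nat.card_sum

theorem locallyFinite_ofSet (A : Set B) : (ofSet A).LocallyFinite := fun b =>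
  have : Subsingleton {m : (ofSet A).apex // (ofSet A).leg m = b} :=
    ⟨fun m m' => Subtype.ext (Subtype.ext (m.2.trans m'.2.symm))⟩
  inferInstance

open Classical in
theorem card_ofSet (A : Set B) (b : B) : (ofSet A).card b = if b ∈ A then 1 else 0 := by
  unfold card
  split_ifs with h
  · rw [Nat.card_eq_one_iff_unique]
    exact ⟨⟨fun m m' => Subtype.ext (Subtype.ext (m.2.trans m'.2.symm))⟩, ⟨⟨⟨b, h⟩, rfl⟩⟩⟩
  · have : IsEmpty {m : (ofSet A).apex // (ofSet A).leg m = b} :=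
      ⟨fun m => h (m.2 ▸ m.1.2)⟩
    exact Nat.card_of_isEmpty

/-- Reparametrization of the apex and of the basis does not change the fibres. -/
def fibreEquiv {S Z : Type*} (F : LinFun B) (σ : S ≃ B) (e : F.apex ≃ Z) (g : Z → S)
    (h : ∀ m, F.leg m = σ (g (e m))) (s : S) :
    {m : F.apex // F.leg m = σ s} ≃ {z : Z // g z = s} :=
  e.subtypeEquiv fun m => by rw [h, σ.apply_eq_iff_eq]

theorem card_eq_of_equiv {S Z : Type*} (F : LinFun B) (σ : S ≃ B) (e : F.apex ≃ Z) (g : Z → S)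
    (h : ∀ m, F.leg m = σ (g (e m))) (s : S) : F.card (σ s) = Nat.card {z : Z // g z = s} :=
  Nat.card_congr (F.fibreEquiv σ e g h s)

theorem locallyFinite_of_equiv {S Z : Type*} (F : LinFun B) (σ : S ≃ B) (e : F.apex ≃ Z)
    (g : Z → S) (h : ∀ m, F.leg m = σ (g (e m))) (hg : ∀ s, Finite {z : Z // g z = s}) :
    F.LocallyFinite := by
  intro b
  obtain ⟨s, rfl⟩ := σ.surjective b
  have := hg s
  exact .of_equiv _ (F.fibreEquiv σ e g h s).symm

end LinFun

section Convolution

variable {M : Type u} [AddCommMonoid M]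

/-- The apex of `ζ * F` consists of pairs of an element of `M` and an element of the apex of `F`. -/
def convZetaEquiv (F : LinFun M) : (conv (zeta M) F).apex ≃ M × F.apex where
  toFun p := p.1.2
  invFun q := ⟨((q.1, F.leg q.2), q), rfl⟩
  left_inv p := by
    obtain ⟨⟨⟨a, b⟩, s, m⟩, h⟩ := p
    exact Subtype.ext (Prod.ext h.symm rfl)
  right_inv _ := rfl

theorem conv_zeta_leg (F : LinFun M) (p : (conv (zeta M) F).apex) :
    (conv (zeta M) F).leg p = (convZetaEquiv F p).1 + F.leg (convZetaEquiv F p).2 := by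
  obtain ⟨⟨⟨a, b⟩, s, m⟩, h⟩ := p
  obtain ⟨rfl, rfl⟩ : a = s ∧ b = F.leg m := Prod.ext_iff.mp h
  rfl

/-- The fibre of `ζ * A` over `n` for a subset `A` of a monoid isomorphic to `ℕ`. -/
def convZetaOfSetFibreEquiv (σ : ℕ ≃+ M) (A : Set M) (n : ℕ) :
    {m : (conv (zeta M) (LinFun.ofSet A)).apex // (conv (zeta M) (LinFun.ofSet A)).leg m = σ n} ≃
      {m : ℕ // m ≤ n ∧ σ m ∈ A} where
  toFun p := ⟨σ.symm (convZetaEquiv _ p.1).2.1, by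
    have h := (conv_zeta_leg _ p.1).symm.trans p.2
    have h' : σ.symm (convZetaEquiv _ p.1).1 + σ.symm (convZetaEquiv _ p.1).2.1 = n := by
      rw [← map_add, AddEquiv.symm_apply_eq]
      exact h
    exact ⟨by omega, by rw [σ.apply_symm_apply]; exact (convZetaEquiv _ p.1).2.2⟩⟩
  invFun m := ⟨(convZetaEquiv _).symm (σ (n - m.1), ⟨σ m.1, m.2.2⟩), by
    rw [conv_zeta_leg, Equiv.apply_symm_apply]
    change σ _ + σ _ = _
    rw [← map_add, Nat.sub_add_cancel m.2.1]⟩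
  left_inv p := by
    obtain ⟨p, hp⟩ := p
    apply Subtype.ext
    obtain ⟨⟨s, a⟩, rfl⟩ := (convZetaEquiv _).symm.surjective p
    rw [conv_zeta_leg, Equiv.apply_symm_apply] at hp
    change s + a.1 = σ n at hp
    simp only [Equiv.apply_symm_apply, EmbeddingLike.apply_eq_iff_eq]
    refine Prod.ext ?_ (Subtype.ext (σ.apply_symm_apply _))
    change σ (n - σ.symm a.1) = s
    have : n = σ.symm s + σ.symm a.1 := by rw [← map_add, hp, σ.symm_apply_apply]
    rw [this, Nat.add_sub_cancel, σ.apply_symm_apply]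
  right_inv m := by
    apply Subtype.ext
    simp

theorem locallyFinite_conv_zeta_ofSet (σ : ℕ ≃+ M) (A : Set M) :
    (conv (zeta M) (LinFun.ofSet A)).LocallyFinite := by
  intro b
  obtain ⟨n, rfl⟩ := σ.surjective b
  have : Finite {m : ℕ // m ≤ n ∧ σ m ∈ A} :=
    ((Set.finite_Iic n).subset fun m hm => hm.1 : {m : ℕ | m ≤ n ∧ σ m ∈ A}.Finite)
  exact .of_equiv _ (convZetaOfSetFibreEquiv σ A n).symm

open Classical in
theorem card_conv_zeta_ofSet (σ : ℕ ≃+ M) (A : Set M) (n : ℕ) :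
    (conv (zeta M) (LinFun.ofSet A)).card (σ n) =
      ((Finset.range (n + 1)).filter fun m => σ m ∈ A).card := by
  refine (Nat.card_congr (convZetaOfSetFibreEquiv σ A n)).trans ?_
  rw [← Nat.card_eq_finsetCard]
  exact Nat.card_congr (Equiv.subtypeEquivRight fun m => by simp)

end Convolution

section PowerSeries

open PowerSeries

theorem constantCoeff_one_sub_C_mul_X_pow (c : ℤ) {d : ℕ} (hd : d ≠ 0) :
    constantCoeff (1 - C c * X ^ d : PowerSeries ℤ) = ((1 : ℤˣ) : ℤ) := by
  simp [hd]

theorem eq_eulerFactor_of_mul_eq_one {c : ℤ} {d : ℕ} (hd : d ≠ 0) {G : PowerSeries ℤ}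
    (hG : G * (1 - C c * X ^ d) = 1) : G = eulerFactor c d :=
  left_inv_eq_right_inv hG (mul_invOfUnit _ _ (constantCoeff_one_sub_C_mul_X_pow c hd))

theorem eulerFactor_mul_self (c : ℤ) {d : ℕ} (hd : d ≠ 0) :
    eulerFactor c d * (1 - C c * X ^ d) = 1 :=
  invOfUnit_mul _ _ (constantCoeff_one_sub_C_mul_X_pow c hd)

/-- The geometric series, rescaled by `c`, with `t ^ d` substituted for `t`. -/
theorem eulerFactor_eq_expand (c : ℤ) {d : ℕ} (hd : d ≠ 0) :
    eulerFactor c d = expand d hd (mk fun n => c ^ n) := by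
  refine (eq_eulerFactor_of_mul_eq_one hd ?_).symm
  have h : (mk fun n => c ^ n) * (1 - C c * X) = (1 : PowerSeries ℤ) := by
    have := congrArg (rescale c) (mk_one_mul_one_sub_eq_one ℤ)
    rw [map_mul, map_sub, map_one, rescale_X] at this
    rwa [show rescale c (mk 1) = mk fun n => c ^ n by ext n; simp] at this
  have := congrArg (expand d hd) h
  rwa [map_mul, map_sub, map_mul, map_one, expand_C, expand_X] at this

theorem eulerFactor_zero {d : ℕ} (hd : d ≠ 0) : eulerFactor 0 d = 1 :=
  (eq_eulerFactor_of_mul_eq_one hd (by simp)).symm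

/-- This is `1 - T² = (1 - T)(1 + T)` with `T = t ^ d`. -/
theorem eulerFactor_mul_two {d : ℕ} (hd : d ≠ 0) :
    eulerFactor 1 (d * 2) = eulerFactor 1 d * eulerFactor (-1) d := by
  refine (eq_eulerFactor_of_mul_eq_one (mul_ne_zero hd two_ne_zero) ?_).symm
  have h1 := eulerFactor_mul_self 1 hd
  have h2 := eulerFactor_mul_self (-1) hd
  simp only [map_one, map_neg] at h1 h2 ⊢
  linear_combination (eulerFactor (-1) d * (1 - -1 * X ^ d)) * h1 + h2

end PowerSeries

end

end HyperellipticIncidence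

/-! ### Counting cycles over `n x` and the generating functions. -/

namespace HyperellipticIncidence

open CategoryTheory AlgebraicGeometry Limits

noncomputable section

section LocalMonoid

variable {k : Type u} [Field k] (x : ClosedPoint (P1 k))

/-- `n ↦ n x` identifies `S_x` with `ℕ`. -/
def multiplesEquiv : ℕ ≃+ localS x where
  toFun n := ⟨Finsupp.single x n, n, by simp⟩
  invFun α := α.1 x
  left_inv n := by simp
  right_inv α := by
    obtain ⟨_, n, rfl⟩ := α
    exact Subtype.ext (by simp)
  map_add' m n := Subtype.ext (Finsupp.single_add x m n)

theorem coe_multiplesEquiv (n : ℕ) : (multiplesEquiv x n).1 = Finsupp.single x n := rfl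

theorem degree_multiplesEquiv (n : ℕ) :
    EffZeroCycle.degree (P1.toSpec k) (multiplesEquiv x n).1 =
      n * (P1.toSpec k).residueDegree x.1 := by
  simp [EffZeroCycle.degree, coe_multiplesEquiv]

/-- Since `deg x > 0`, the degree is injective on `S_x` with image the multiples of `deg x`, so each
coefficient is a sum of at most one term. -/
theorem genFun_eq_expand {x : ClosedPoint (P1 k)} (hd : (P1.toSpec k).residueDegree x.1 ≠ 0)
    (F : LinFun (localS x)) :
    genFun F = PowerSeries.expand _ hd
      (PowerSeries.mk fun n => (F.card (multiplesEquiv x n) : ℤ)) := by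
  ext d
  rw [genFun, PowerSeries.coeff_mk, PowerSeries.coeff_expand]
  split_ifs with h
  · obtain ⟨n, rfl⟩ := h
    have huniq (α : localS x) (hα : EffZeroCycle.degree (P1.toSpec k) α.1 =
        (P1.toSpec k).residueDegree x.1 * n) : α = multiplesEquiv x n := by
      obtain ⟨m, rfl⟩ := (multiplesEquiv x).surjective α
      rw [degree_multiplesEquiv, mul_comm] at hα
      rw [Nat.eq_of_mul_eq_mul_left (Nat.pos_of_ne_zero hd) hα]
    let : Unique {α : localS x // EffZeroCycle.degree (P1.toSpec k) α.1 =
        (P1.toSpec k).residueDegree x.1 * n} :=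
      { default := ⟨multiplesEquiv x n, by rw [degree_multiplesEquiv, mul_comm]⟩
        uniq α := Subtype.ext (huniq _ α.2) }
    rw [finsum_unique, PowerSeries.coeff_mk, Nat.mul_div_cancel_left _ (Nat.pos_of_ne_zero hd)]
    rfl
  · have : IsEmpty {α : localS x // EffZeroCycle.degree (P1.toSpec k) α.1 = d} := by
      refine ⟨fun α => h ?_⟩
      obtain ⟨m, hm⟩ := (multiplesEquiv x).surjective α.1
      rw [← α.2, ← hm, degree_multiplesEquiv]
      exact dvd_mul_left _ _
    exact finsum_of_isEmpty _

theorem locallyFinite_zeta (M : Type u) : (zeta M).LocallyFinite := fun b =>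
  have : Subsingleton {m : (zeta M).apex // (zeta M).leg m = b} :=
    ⟨fun m m' => Subtype.ext (m.2.trans m'.2.symm)⟩
  inferInstance

theorem card_zeta {M : Type u} (b : M) : (zeta M).card b = 1 :=
  Nat.card_eq_one_iff_unique.mpr
    ⟨⟨fun m m' => Subtype.ext (m.2.trans m'.2.symm)⟩, ⟨⟨b, rfl⟩⟩⟩

theorem card_conv_zeta_ofSet_eq_sum {M : Type u} [AddCommMonoid M] (σ : ℕ ≃+ M) (A : Set M)
    (n : ℕ) : (conv (zeta M) (LinFun.ofSet A)).card (σ n) =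
      ∑ m ∈ Finset.range (n + 1), (LinFun.ofSet A).card (σ m) := by
  classical
  simp_rw [card_conv_zeta_ofSet, LinFun.card_ofSet, Finset.card_filter]

theorem genFun_zeta : genFun (zeta (localS x)) = localZetaP1 x := by
  rw [genFun_eq_expand (degree_pos x).ne', localZetaP1, eulerFactor_eq_expand 1 (degree_pos x).ne']
  simp [card_zeta]

end LocalMonoid

namespace HyperellipticCurve

variable {k : Type u} [Field k] (H : HyperellipticCurve k) (x : ClosedPoint (P1 k))

theorem pushforward_single (y : ClosedPoint H.C) (n : ℕ) :
    EffZeroCycle.pushforward H.π (Finsupp.single y n) =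
      Finsupp.single (ClosedPoint.map H.π y) (n * H.inertiaDegree y) := by
  simp [EffZeroCycle.pushforward, inertiaDegree]

theorem pushforward_sum_single [Fintype (H.Fibre x)] (c : H.Fibre x → ℕ) :
    EffZeroCycle.pushforward H.π (∑ y, Finsupp.single y.1 (c y)) =
      (multiplesEquiv x (∑ y, c y * H.inertiaDegree y.1)).1 := by
  rw [map_sum, coe_multiplesEquiv, Finsupp.single_finsetSum]
  exact Finset.sum_congr rfl fun y _ => by rw [pushforward_single, y.2]

/-- Effective cycles cannot cancel under pushforward, and `f(y|π(y)) > 0`, so a point outside the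
fibre would leave a nonzero coefficient away from `x`. -/
theorem eq_zero_of_mem_localT {β : EffZeroCycle H.C} (hβ : β ∈ H.localT x) {y : ClosedPoint H.C}
    (hy : ClosedPoint.map H.π y ≠ x) : β y = 0 := by
  obtain ⟨n, hn⟩ := hβ
  have h : EffZeroCycle.pushforward H.π β (ClosedPoint.map H.π y) = 0 := by
    rw [← hn]
    simp [hy.symm]
  have hsplit : β = Finsupp.single y (β y) + β.erase y := (Finsupp.single_add_erase y β).symm
  rw [hsplit, map_add, pushforward_single, Finsupp.add_apply, Finsupp.single_eq_same,
    Nat.add_eq_zero_iff, mul_eq_zero] at h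
  exact h.1.resolve_right (H.inertiaDegree_pos _ ⟨y, rfl⟩).ne'

theorem sum_single_apply [Fintype (H.Fibre x)] (c : H.Fibre x → ℕ) (y : H.Fibre x) :
    (∑ y, Finsupp.single y.1 (c y) : EffZeroCycle H.C) y.1 = c y := by
  classical
  rw [Finsupp.finsetSum_apply]
  simp [Finsupp.single_apply, Subtype.val_inj]

/-- Cycles in `T_x` are families of multiplicities on the fibre over `x`. -/
def localTEquiv [Fintype (H.Fibre x)] : H.localT x ≃ (H.Fibre x → ℕ) where
  toFun β y := β.1 y.1
  invFun c := ⟨∑ y, Finsupp.single y.1 (c y), by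
    change EffZeroCycle.pushforward H.π _ ∈ localS x
    rw [pushforward_sum_single]
    exact (multiplesEquiv x _).2⟩
  left_inv β := by
    refine Subtype.ext (Finsupp.ext fun y => ?_)
    by_cases hy : ClosedPoint.map H.π y = x
    · exact H.sum_single_apply x _ ⟨y, hy⟩
    · rw [H.eq_zero_of_mem_localT x β.2 hy, Finsupp.finsetSum_apply]
      refine Finset.sum_eq_zero fun z _ => Finsupp.single_eq_of_ne ?_
      rintro rfl
      exact hy z.2
  right_inv c := funext fun y => H.sum_single_apply x c y

theorem pushZeta_leg [Fintype (H.Fibre x)] (β : (H.pushZeta x).apex) :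
    (H.pushZeta x).leg β =
      multiplesEquiv x (∑ y, H.localTEquiv x β y * H.inertiaDegree y.1) := by
  obtain ⟨c, rfl⟩ := (H.localTEquiv x).symm.surjective β
  rw [Equiv.apply_symm_apply]
  exact Subtype.ext (H.pushforward_sum_single x c)

/-- As all `f(y|x) ≥ 1`, each multiplicity of a cycle over `n x` is at most `n`. -/
theorem locallyFinite_pushZeta : (H.pushZeta x).LocallyFinite := by
  classical
  let := Fintype.ofFinite (H.Fibre x)
  refine (H.pushZeta x).locallyFinite_of_equiv (multiplesEquiv x).toEquiv (H.localTEquiv x)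
    (fun c => ∑ y, c y * H.inertiaDegree y.1) (H.pushZeta_leg x) fun n => ?_
  refine ((Set.finite_Iic fun _ : H.Fibre x => n).subset fun c hc y => ?_ :
    {c : H.Fibre x → ℕ | ∑ y, c y * H.inertiaDegree y.1 = n}.Finite)
  exact (Nat.le_mul_of_pos_right _ (H.inertiaDegree_pos x y)).trans
    ((Finset.single_le_sum (f := fun y => c y * H.inertiaDegree y.1) (fun _ _ => Nat.zero_le _)
      (Finset.mem_univ y)).trans_eq hc)

theorem card_pushZeta [Fintype (H.Fibre x)] (n : ℕ) :
    (H.pushZeta x).card (multiplesEquiv x n) =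
      Nat.card {c : H.Fibre x → ℕ // ∑ y, c y * H.inertiaDegree y.1 = n} :=
  (H.pushZeta x).card_eq_of_equiv (multiplesEquiv x).toEquiv (H.localTEquiv x) _
    (H.pushZeta_leg x) n

theorem card_pushZeta_of_unique {y : H.Fibre x} (hy : ∀ y', y' = y) (n : ℕ) :
    (H.pushZeta x).card (multiplesEquiv x n) = if H.inertiaDegree y.1 ∣ n then 1 else 0 := by
  let : Unique (H.Fibre x) := ⟨⟨y⟩, hy⟩
  have hpos := H.inertiaDegree_pos x y
  rw [card_pushZeta]
  simp_rw [Fintype.sum_unique]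
  change Nat.card {c : H.Fibre x → ℕ // c y * H.inertiaDegree y.1 = n} = _
  split_ifs with h
  · obtain ⟨m, rfl⟩ := h
    rw [Nat.card_eq_one_iff_unique]
    refine ⟨⟨fun c c' => Subtype.ext (funext fun y' => ?_)⟩, ⟨fun _ => m, mul_comm _ _⟩⟩
    rw [hy y']
    exact Nat.eq_of_mul_eq_mul_right hpos (c.2.trans c'.2.symm)
  · have : IsEmpty {c : H.Fibre x → ℕ // c y * H.inertiaDegree y.1 = n} :=
      ⟨fun c => h ⟨c.1 y, by rw [mul_comm, c.2]⟩⟩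
    exact Nat.card_of_isEmpty

theorem univ_fibre_eq_pair [Fintype (H.Fibre x)] [DecidableEq (H.Fibre x)] {y₁ y₂ : H.Fibre x}
    (hy : ∀ y', y' = y₁ ∨ y' = y₂) : (Finset.univ : Finset (H.Fibre x)) = {y₁, y₂} := by
  ext y
  simpa using hy y

/-- A solution of `c₁ + c₂ = n` is determined by `c₁ ∈ {0, …, n}`. -/
theorem card_pushZeta_of_pair {y₁ y₂ : H.Fibre x} (hne : y₁ ≠ y₂) (hy : ∀ y', y' = y₁ ∨ y' = y₂)
    (hf : ∀ y' : H.Fibre x, H.inertiaDegree y'.1 = 1) (n : ℕ) :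
    (H.pushZeta x).card (multiplesEquiv x n) = n + 1 := by
  classical
  let := Fintype.ofFinite (H.Fibre x)
  rw [card_pushZeta]
  simp_rw [hf, mul_one, H.univ_fibre_eq_pair x hy, Finset.sum_pair hne]
  rw [← Nat.card_fin (n + 1)]
  refine Nat.card_eq_of_bijective (fun c => ⟨c.1 y₁, by have := c.2; omega⟩) ⟨?_, fun m => ?_⟩
  · intro c c' h
    have h1 : c.1 y₁ = c'.1 y₁ := congrArg Fin.val h
    have hc := c.2
    have hc' := c'.2
    refine Subtype.ext (funext fun y => ?_)
    obtain rfl | rfl := hy y <;> omega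
  · exact ⟨⟨fun y => if y = y₁ then m else n - m, by
      have := m.2
      simp only [if_true, hne.symm, if_false]
      omega⟩, Fin.ext (by simp)⟩

theorem localZeta_of_unique {y : H.Fibre x} (hy : ∀ y', y' = y) :
    H.localZeta x =
      eulerFactor 1 ((P1.toSpec k).residueDegree x.1 * H.inertiaDegree y.1) := by
  let : Unique (H.Fibre x) := ⟨⟨y⟩, hy⟩
  rw [localZeta, finprod_unique, residueDegree_fibre]
  rfl

theorem localZeta_of_pair {y₁ y₂ : H.Fibre x} (hne : y₁ ≠ y₂) (hy : ∀ y', y' = y₁ ∨ y' = y₂)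
    (hf : ∀ y' : H.Fibre x, H.inertiaDegree y'.1 = 1) :
    H.localZeta x = localZetaP1 x * localZetaP1 x := by
  classical
  let := Fintype.ofFinite (H.Fibre x)
  rw [localZeta, finprod_eq_prod_of_fintype]
  simp_rw [residueDegree_fibre, hf, mul_one, H.univ_fibre_eq_pair x hy, Finset.prod_pair hne]
  rfl

/-- The splitting type of `x`, with its effect on `χ`, on the cycles over `x` and on the Euler
factor. -/
theorem splitting_cases :
    ((H.IsRamified x ∧ ¬ H.IsSplit x ∧ ¬ H.IsInert x) ∧
      (∀ n, (H.pushZeta x).card (multiplesEquiv x n) = 1) ∧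
      H.localZeta x = localZetaP1 x) ∨
    ((¬ H.IsRamified x ∧ H.IsSplit x ∧ ¬ H.IsInert x) ∧
      (∀ n, (H.pushZeta x).card (multiplesEquiv x n) = n + 1) ∧
      H.localZeta x = localZetaP1 x * localZetaP1 x) ∨
    ((¬ H.IsRamified x ∧ ¬ H.IsSplit x ∧ H.IsInert x) ∧
      (∀ n, (H.pushZeta x).card (multiplesEquiv x n) = if 2 ∣ n then 1 else 0) ∧
      H.localZeta x = eulerFactor 1 ((P1.toSpec k).residueDegree x.1 * 2)) := by
  obtain ⟨y, hy, he, hf⟩ | ⟨y₁, y₂, hne, hy, hef⟩ | ⟨y, hy, he, hf⟩ := H.fibre_trichotomy x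
  · refine .inl ⟨⟨⟨y, by omega⟩, fun h => ?_, ?_⟩, fun n => ?_, ?_⟩
    · have := (h y).1
      omega
    · rintro ⟨z, -, h⟩
      rw [hy z] at h
      omega
    · rw [H.card_pushZeta_of_unique x hy, hf, if_pos (one_dvd n)]
    · rw [H.localZeta_of_unique x hy, hf, mul_one, localZetaP1]
  · refine .inr (.inl ⟨⟨?_, hef, ?_⟩, H.card_pushZeta_of_pair x hne hy fun y => (hef y).2,
      H.localZeta_of_pair x hne hy fun y => (hef y).2⟩)
    · rintro ⟨y, h⟩
      have := (hef y).1
      omega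
    · rintro ⟨z, hz, -⟩
      exact hne ((hz y₁).trans (hz y₂).symm)
  · refine .inr (.inr ⟨⟨?_, fun h => ?_, y, hy, he⟩, fun n => ?_, ?_⟩)
    · rintro ⟨z, h⟩
      rw [hy z] at h
      omega
    · have := (h y).2
      omega
    · rw [H.card_pushZeta_of_unique x hy, hf]
    · rw [H.localZeta_of_unique x hy, hf]

theorem locallyFinite_LPlus : (H.LPlus x).LocallyFinite := LinFun.locallyFinite_ofSet _

theorem locallyFinite_LMinus : (H.LMinus x).LocallyFinite := LinFun.locallyFinite_ofSet _

/-- The sets are the supports of the positive and negative values of `n ↦ χ(x)^n`; in the ramified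
case `0 ^ 0 = 1` accounts for `{0}`. -/
theorem card_LPlus_sub_card_LMinus (n : ℕ) :
    ((H.LPlus x).card (multiplesEquiv x n) : ℤ) - (H.LMinus x).card (multiplesEquiv x n) =
      H.chi x ^ n := by
  classical
  rw [LPlus, LMinus, LinFun.card_ofSet, LinFun.card_ofSet]
  simp only [setPlus, setMinus, Set.mem_ofPred_eq, EmbeddingLike.map_eq_zero_iff,
    coe_multiplesEquiv, (Finsupp.single_injective x).eq_iff, chi]
  obtain ⟨⟨hR, hS, hI⟩, -⟩ | ⟨⟨hR, hS, hI⟩, -⟩ | ⟨⟨hR, hS, hI⟩, -⟩ := H.splitting_cases x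
  · simp [hR, hS, hI, zero_pow_eq]
  · simp [hR, hS, hI]
  · have h : (∃ m, n = 2 * m) ↔ Even n := even_iff_exists_two_mul.symm
    have h' : (∃ m, n = 2 * m + 1) ↔ ¬ Even n := Nat.not_even_iff_odd.symm
    by_cases hn : Even n
    · simp [hR, hS, hI, h, h', hn]
    · simp [hR, hS, hI, h, h', hn, (Nat.not_even_iff_odd.mp hn).neg_one_pow]

/-- The objective form of `ζ_C = ζ_{ℙ¹} * L` after taking cardinalities: the sums are 1, `n + 1` and
the parity indicator. -/
theorem card_pushZeta_eq_sum (n : ℕ) :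
    ((H.pushZeta x).card (multiplesEquiv x n) : ℤ) =
      ∑ m ∈ Finset.range (n + 1), H.chi x ^ m := by
  obtain ⟨⟨hR, hS, hI⟩, h, -⟩ | ⟨⟨hR, hS, hI⟩, h, -⟩ | ⟨⟨hR, hS, hI⟩, h, -⟩ :=
    H.splitting_cases x <;> rw [h]
  · simp [chi, hR, Finset.sum_range_succ']
  · simp [chi, hR, hS]
  · simp only [chi, hR, hS, if_false, neg_one_geom_sum, Nat.even_add_one, ← even_iff_two_dvd]
    split_ifs <;> simp_all

/-- The negative terms of the preceding sum are moved to the other side, which gives an identity in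
`ℕ` that bijections can realize. -/
theorem card_pushZeta_add_conv (n : ℕ) :
    (H.pushZeta x).card (multiplesEquiv x n) +
        (conv (zeta (localS x)) (H.LMinus x)).card (multiplesEquiv x n) =
      (conv (zeta (localS x)) (H.LPlus x)).card (multiplesEquiv x n) := by
  have h := H.card_pushZeta_eq_sum x n
  simp_rw [← card_LPlus_sub_card_LMinus, Finset.sum_sub_distrib] at h
  rw [LMinus, LPlus, card_conv_zeta_ofSet_eq_sum, card_conv_zeta_ofSet_eq_sum]
  rw [LMinus, LPlus] at h
  zify
  linarith

theorem spanEquiv_pushZeta_add_conv :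
    ((H.pushZeta x).add (conv (zeta (localS x)) (H.LMinus x))).SpanEquiv
      (conv (zeta (localS x)) (H.LPlus x)) := by
  have h := H.locallyFinite_pushZeta x
  have hM : (conv (zeta (localS x)) (H.LMinus x)).LocallyFinite :=
    locallyFinite_conv_zeta_ofSet (multiplesEquiv x) _
  refine LinFun.spanEquiv_of_card_eq (h.add hM)
    (locallyFinite_conv_zeta_ofSet (multiplesEquiv x) _) fun b => ?_
  obtain ⟨n, rfl⟩ := (multiplesEquiv x).surjective b
  rw [LinFun.card_add h hM]
  exact H.card_pushZeta_add_conv x n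

theorem genFun_LPlus_sub_genFun_LMinus :
    genFun (H.LPlus x) - genFun (H.LMinus x) = H.localL x := by
  rw [genFun_eq_expand (degree_pos x).ne', genFun_eq_expand (degree_pos x).ne', ← map_sub, localL,
    eulerFactor_eq_expand _ (degree_pos x).ne']
  congr 1
  ext n
  simp [card_LPlus_sub_card_LMinus]

theorem localZeta_eq : H.localZeta x = localZetaP1 x * H.localL x := by
  have hd := (degree_pos x).ne'
  obtain ⟨⟨hR, hS, hI⟩, -, h⟩ | ⟨⟨hR, hS, hI⟩, -, h⟩ | ⟨⟨hR, hS, hI⟩, -, h⟩ :=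
    H.splitting_cases x <;> rw [h, localL, chi]
  · rw [if_pos hR, eulerFactor_zero hd, mul_one]
  · rw [if_neg hR, if_pos hS, localZetaP1]
  · rw [if_neg hR, if_neg hS, localZetaP1, eulerFactor_mul_two hd]

/-- In `T = t^{deg x}`, the coefficients of `1/((1 - T)(1 - χ(x) T))` are the partial sums of the
powers of `χ(x)`, which are the cardinalities already found. -/
theorem genFun_pushZeta : genFun (H.pushZeta x) = H.localZeta x := by
  have hd := (degree_pos x).ne'
  rw [localZeta_eq, genFun_eq_expand hd, localZetaP1, localL, eulerFactor_eq_expand _ hd,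
    eulerFactor_eq_expand _ hd, ← map_mul]
  congr 1
  ext n
  rw [mul_comm, PowerSeries.coeff_mul, Finset.Nat.sum_antidiagonal_eq_sum_range_succ_mk]
  simp [card_pushZeta_eq_sum]

end HyperellipticCurve

end

end HyperellipticIncidence

open HyperellipticIncidence in
theorem theorem4p1 {k : Type u} [Field k] [Finite k] (H : HyperellipticCurve k)
    (x : ClosedPoint (P1 k)) :
    -- `x` has exactly one splitting type
    ((H.IsRamified x ∧ ¬ H.IsSplit x ∧ ¬ H.IsInert x) ∨
      (¬ H.IsRamified x ∧ H.IsSplit x ∧ ¬ H.IsInert x) ∨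
      (¬ H.IsRamified x ∧ ¬ H.IsSplit x ∧ H.IsInert x)) ∧
    -- the equivalence of linear functors, and of the spans that represent them
    LinFun.FunctorEquiv
      ((H.pushZeta x).add (conv (zeta (localS x)) (H.LMinus x)))
      (conv (zeta (localS x)) (H.LPlus x)) ∧
    LinFun.SpanEquiv
      ((H.pushZeta x).add (conv (zeta (localS x)) (H.LMinus x)))
      (conv (zeta (localS x)) (H.LPlus x)) ∧
    -- all cardinalities are finite
    ((H.pushZeta x).LocallyFinite ∧ (zeta (localS x)).LocallyFinite ∧
      (H.LPlus x).LocallyFinite ∧ (H.LMinus x).LocallyFinite) ∧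
    -- their generating functions are the local factors
    (genFun (H.pushZeta x) = H.localZeta x ∧
      genFun (zeta (localS x)) = localZetaP1 x ∧
      genFun (H.LPlus x) - genFun (H.LMinus x) = H.localL x) ∧
    -- the identity of local factors
    H.localZeta x = localZetaP1 x * H.localL x := by
  have h := H.spanEquiv_pushZeta_add_conv x
  refine ⟨?_, h.functorEquiv, h, ⟨H.locallyFinite_pushZeta x, locallyFinite_zeta _,
    H.locallyFinite_LPlus x, H.locallyFinite_LMinus x⟩, ⟨H.genFun_pushZeta x, genFun_zeta x,
    H.genFun_LPlus_sub_genFun_LMinus x⟩, H.localZeta_eq x⟩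
  exact (H.splitting_cases x).imp And.left (Or.imp And.left And.left)
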